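/- For $k\ge 1$ let $n=2\cdot 2^k$ and $m=\lfloor 2^k/k\rfloor$ (so $m=2^k/k$ when $k$ is a power of two). Andreev's function takes as input $x\in\{0,1\}^{2^k}$ and bits $a_{i,j}\in\{0,1\}$ ($1\le i\le k$, $1\le j\le m$), which are $n$ bits in all when $k$ is a power of two, and is defined by $A_n(x,a)=x_{\mathrm{bin}(b_1\cdots b_k)}$ with $b_i=\sum_{j=1}^m a_{i,j}\bmod 2$, where $\mathrm{bin}(b_1\cdots b_k)=1+\sum_{i=1}^k b_i2^{k-i}$. A linear threshold gate with input wires $y_1,\dots,y_r\in\{0,1\}$ outputs $1$ if and only if $\sum_i w_iy_i\ge t$, where $w_1,\dots,w_r,t\in\mathbb R$ are arbitrary. An $\mathsf{LTF}\circ\mathsf{LTF}$ circuit consists of linear threshold gates that read input variables, and one output linear threshold gate that reads input variables and outputs of the other gates; its number of gates includes the output gate, and its number of wires is the sum of the fan-ins of all its gates. There are absolute constants $K,c>0$ such that, for every $k\ge 1$, with $n=2\cdot 2^k$, and every real $\varepsilon\ge K\sqrt{\log n/n}$: if a Boolean function $f$ agrees with $A_n$ on at least a $(1/2+\varepsilon)$-fraction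 of all inputs, then every $\mathsf{LTF}\circ\mathsf{LTF}$ circuit that computes $f$ has at least $c\,\varepsilon^3n^{3/2}/\log^3 n$ gates and at least $c\,\varepsilon^3n^{5/2}/\log^{7/2}n$ wires. -/

import Mathlib

noncomputable section

/-- A linear threshold gate reading wires from sources indexed by `α`: the set `inputs` of sources
wired into the gate, a real weight on each wire, and a real threshold. -/
structure LTFGate (α : Type) where
  inputs : Finset α
  weight : α → ℝ
  threshold : ℝ

/-- The output of the gate: `1` iff the weighted sum of its inputs is at least the threshold. -/
def LTFGate.eval {α : Type} (g : LTFGate α) (z : α → Bool) : Bool :=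
  decide (g.threshold ≤ ∑ i ∈ g.inputs, g.weight i * (if z i then 1 else 0))

/-- A depth-two linear threshold circuit (`LTF ∘ LTF`) on variables indexed by `ι`: bottom gates
that read the variables, and one output gate that reads variables and bottom gates. -/
structure LTFLTFCircuit (ι : Type) where
  numBottom : ℕ
  bottom : Fin numBottom → LTFGate ι
  top : LTFGate (ι ⊕ Fin numBottom)

namespace LTFLTFCircuit

/-- The Boolean function computed by the circuit. -/
def eval {ι : Type} (C : LTFLTFCircuit ι) (z : ι → Bool) : Bool :=
  C.top.eval (Sum.elim z (fun j => (C.bottom j).eval z))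

/-- The number of gates, the output gate included. -/
def gates {ι : Type} (C : LTFLTFCircuit ι) : ℕ := C.numBottom + 1

/-- The number of wires: the total fan-in of all gates. -/
def wires {ι : Type} (C : LTFLTFCircuit ι) : ℕ :=
  (∑ j, (C.bottom j).inputs.card) + C.top.inputs.card

end LTFLTFCircuit

/-- The integer (counted from `0`) with binary expansion `a`, most significant bit first. -/
def binIndex {k : ℕ} (a : Fin k → Bool) : Fin (2 ^ k) :=
  finFunctionFinEquiv (fun i : Fin k => if a i.rev then (1 : Fin 2) else 0)

/-- The `k`-bit multiplexer `M_{2^k}(x, a) = x_{bin(a)}`. -/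
def multiplexer {k : ℕ} (x : Fin (2 ^ k) → Bool) (a : Fin k → Bool) : Bool := x (binIndex a)

/-- The variables of Andreev's function: `x_1, …, x_{2^k}`, and `k` blocks `a_{i,1}, a_{i,2}, …`
of `2^k / k` variables each (rounded down when `k` does not divide `2^k`). -/
abbrev AndreevVar (k : ℕ) : Type := Fin (2 ^ k) ⊕ (Fin k × Fin (2 ^ k / k))

/-- Andreev's function: the multiplexer applied to `x` and to the parities of the `k` blocks. -/
def andreev (k : ℕ) (z : AndreevVar k → Bool) : Bool :=
  multiplexer (fun p => z (Sum.inl p))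
    (fun i => decide ((∑ j : Fin (2 ^ k / k), if z (Sum.inr (i, j)) then (1 : ℕ) else 0) % 2 = 1))

/-- The fraction of inputs on which two Boolean functions agree. -/
def agreement {ι : Type} [Fintype ι] [DecidableEq ι] (f g : (ι → Bool) → Bool) : ℝ :=
  ((Finset.univ.filter (fun z : ι → Bool => f z = g z)).card : ℝ) / (2 : ℝ) ^ Fintype.card ι

end

namespace Andreev
open Finset
open scoped BigOperators

/-! Choose one live variable `J i` uniformly in each block, fix the other block variables and `x` at
random, and leave the live bits `y` free. Each live bit flips the parity of its block, so the live
bits correspond bijectively to addresses, and the restricted Andreev function has `x` itself,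
permuted, as truth table. The restricted circuit must therefore correlate with the random table `x`
(`expect_correlation_eq`).

A bottom gate that becomes constant, or keeps at most one live input, is affine in `y` and merges
into the output gate (`isAffine_of_not_survives`). With at most `s` surviving gates, the restricted
circuit lies in a class of `2 ^ O(k² s)` functions when `s ≥ 1` (`card_depthTwoFunctions_le`,
`restrictedEval_mem`). An exponential-moment union bound over this class shows that its functions
correlate little with `x` on average, even when the function is chosen after seeing `x`
(`correlation_le`). Markov's inequality controls the event of more than `s` survivors, and
`main_inequality` combines these bounds.

The remaining ingredient is the survival probability of a threshold gate reading a set `D` of block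
variables, with `m` variables per block. A threshold function is monotone in each variable, so this
probability is bounded by the mean difference of the gate at its two extreme live assignments.
Reweighting turns that difference into a correlation with a product over independent blocks, which
Cauchy–Schwarz bounds by `O(√|D| / m)`. When `D` is small, the requirement of two live inputs
removes the first-order part up to a small correction, and the bound becomes `O(|D| / m^(3/2))`.
Summed over gates, the first bound gives the gate count and the second the wire count.

If `ε` is too small to allow even one survivor, the output gate alone accounts for the gate bound.
The wire bound then holds because either enough gates survive on average or the circuit reads many
of the variables `x_p` (`survivors_or_reads`). -/

/-- The sign `±1` of a bit. -/
noncomputable def pm (b : Bool) : ℝ := if b then 1 else -1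

/-- The bit as a real number. -/
noncomputable def bit (b : Bool) : ℝ := if b then 1 else 0

/-! ### Counting linear threshold functions -/

theorem sum_choose_le (N D : ℕ) : ∑ i ∈ Iic D, N.choose i ≤ (N + 1) ^ D := by
  induction D with
  | zero => rw [show Iic 0 = {0} from rfl]; simp
  | succ D ih =>
    have h : Iic (D + 1) = insert (D + 1) (Iic D) := by ext; simp; omega
    rw [h, sum_insert (by simp)]
    have h1 : N.choose (D + 1) ≤ N ^ D * N := by rw [← pow_succ]; exact Nat.choose_le_pow _ _
    have h2 : N ^ D * N ≤ (N + 1) ^ D * N := by gcongr; omega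
    calc _ ≤ (N + 1) ^ D * N + (N + 1) ^ D := by omega
      _ = _ := by ring

theorem card_le_of_no_large_shattered {X : Type*} [Fintype X] [DecidableEq X]
    (A : Finset (Finset X)) (D : ℕ) (h : ∀ s, A.Shatters s → s.card ≤ D) :
    A.card ≤ (Fintype.card X + 1) ^ D := by
  have hv : A.vcDim ≤ D := Finset.sup_le fun s hs => h s (mem_shatterer.1 hs)
  calc A.card ≤ A.shatterer.card := card_le_card_shatterer A
    _ ≤ ∑ i ∈ Iic A.vcDim, (Fintype.card X).choose i := card_shatterer_le_sum_vcDim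
    _ ≤ ∑ i ∈ Iic D, (Fintype.card X).choose i :=
      sum_le_sum_of_subset (Iic_subset_Iic.2 hv)
    _ ≤ _ := sum_choose_le _ _

open Classical in
/-- The Boolean functions on `X` that are affine threshold functions of the features `φ`. -/
noncomputable def thresholdFunctions {X ι : Type*} [Fintype X] [Fintype ι] (φ : X → ι → ℝ) :
    Finset (X → Bool) :=
  univ.filter fun f => ∃ (w : ι → ℝ) (θ : ℝ), ∀ x, f x = decide (θ ≤ ∑ i, w i * φ x i)

theorem mem_thresholdFunctions {X ι : Type*} [Fintype X] [Fintype ι] {φ : X → ι → ℝ}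
    {f : X → Bool} : f ∈ thresholdFunctions φ ↔
      ∃ (w : ι → ℝ) (θ : ℝ), ∀ x, f x = decide (θ ≤ ∑ i, w i * φ x i) := by
  simp [thresholdFunctions]

-- A shattered set has at most `|ι| + 1` points, because its vectors `(φ x, 1)` are linearly
-- independent; Sauer–Shelah then gives the count.
open Classical in
theorem card_thresholdFunctions_le {X ι : Type*} [Fintype X] [Fintype ι]
    (φ : X → ι → ℝ) :
    (thresholdFunctions φ).card ≤ (Fintype.card X + 1) ^ (Fintype.card ι + 1) := by
  set A : Finset (Finset X) := (thresholdFunctions φ).image fun f => univ.filter fun x => f x = true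
    with hA
  have hc : (thresholdFunctions φ).card = A.card := by
    rw [hA, card_image_of_injective]
    intro f g hfg
    funext x
    have := Finset.ext_iff.1 hfg x
    simp only [mem_filter, mem_univ, true_and] at this
    exact Bool.eq_iff_iff.2 this
  rw [hc]
  refine card_le_of_no_large_shattered A _ fun s hs => ?_
  by_contra hlt
  push Not at hlt
  let v : s → (ι → ℝ) × ℝ := fun x => (φ x, 1)
  have hdep : ¬ LinearIndependent ℝ v := by
    intro hli
    have := hli.fintype_card_le_finrank
    simp at this
    omega
  obtain ⟨g, hg, hne⟩ := Fintype.not_linearIndependent_iff.1 hdep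
  have key : ∀ (w : ι → ℝ) (θ : ℝ), ∑ x, g x * ((∑ i, w i * φ x i) - θ) = 0 := by
    intro w θ
    have h1 : ∀ i, ∑ x, g x * φ x i = 0 := by
      intro i
      have := congrFun (congrArg Prod.fst hg) i
      simpa [v, Prod.fst_sum, Finset.sum_apply] using this
    have h2 : ∑ x, g x = 0 := by
      have := congrArg Prod.snd hg
      simpa [v, Prod.snd_sum] using this
    simp only [mul_sub, sum_sub_distrib, ← sum_mul, h2, zero_mul, sub_zero, mul_sum]
    rw [sum_comm]
    refine sum_eq_zero fun i _ => ?_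
    calc _ = w i * ∑ x, g x * φ x i := by rw [mul_sum]; exact sum_congr rfl fun x _ => by ring
      _ = 0 := by rw [h1, mul_zero]
  -- The sign is normalized so that some coefficient is negative. A threshold function that is true
  -- exactly where `g ≥ 0` is strictly below threshold at `x₀`, so the relation acquires a strictly
  -- positive term.
  obtain ⟨g, key, x₀, hx₀⟩ : ∃ g : s → ℝ,
      (∀ (w : ι → ℝ) (θ : ℝ), ∑ x, g x * ((∑ i, w i * φ x i) - θ) = 0) ∧ ∃ x, g x < 0 := by
    obtain ⟨x, hx⟩ := hne
    rcases lt_or_gt_of_ne hx with h | h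
    · exact ⟨g, key, x, h⟩
    · refine ⟨fun x => -g x, fun w θ => ?_, x, by simpa using h⟩
      simp only [neg_mul, sum_neg_distrib, key, neg_zero]
  obtain ⟨u, hu, hsu⟩ := hs (t := s.filter fun x => ∃ h : x ∈ s, 0 ≤ g ⟨x, h⟩) (filter_subset _ _)
  obtain ⟨f, hf, rfl⟩ := mem_image.1 hu
  obtain ⟨w, θ, hw⟩ := mem_thresholdFunctions.1 hf
  have hiff : ∀ x : s, θ ≤ ∑ i, w i * φ x i ↔ 0 ≤ g x := by
    intro x
    have := Finset.ext_iff.1 hsu x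
    simpa [hw] using this
  have hpos : 0 < ∑ x, g x * ((∑ i, w i * φ x i) - θ) := by
    refine sum_pos' (fun x _ => ?_) ⟨x₀, mem_univ _, ?_⟩
    · by_cases h : 0 ≤ g x
      · exact mul_nonneg h (sub_nonneg.2 ((hiff x).2 h))
      · have := (hiff x).not.2 h
        exact mul_nonneg_of_nonpos_of_nonpos (by linarith) (by linarith)
    · have := (hiff x₀).not.2 (by linarith)
      exact mul_pos_of_neg_of_neg hx₀ (by linarith)
  exact hpos.ne' (key w θ)

/-- The Boolean functions of `k` bits that are threshold functions of the bits and of at most `s`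
threshold functions of the bits. -/
noncomputable def depthTwoFunctions (k s : ℕ) : Finset ((Fin k → Bool) → Bool) := by
  classical
  exact (Fintype.piFinset fun _ : Fin s =>
      thresholdFunctions (fun (y : Fin k → Bool) i => bit (y i))).biUnion fun g =>
    thresholdFunctions fun y (i : Fin k ⊕ Fin s) =>
      Sum.elim (fun i => bit (y i)) (fun j => bit (g j y)) i

theorem card_depthTwoFunctions_le (k s : ℕ) :
    (depthTwoFunctions k s).card ≤ 2 ^ ((k + 1) * ((k + 1) * s + (k + s + 1))) := by
  classical
  have hN : ∀ e, (Fintype.card (Fin k → Bool) + 1) ^ e ≤ 2 ^ ((k + 1) * e) := by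
    intro e
    rw [pow_mul]
    gcongr
    simp only [Fintype.card_pi, Fintype.card_bool, prod_const, card_univ, Fintype.card_fin,
      pow_succ]
    have := Nat.one_le_two_pow (n := k)
    omega
  rw [depthTwoFunctions]
  refine (card_biUnion_le_card_mul _ _ (2 ^ ((k + 1) * (k + s + 1))) fun g _ => ?_).trans ?_
  · refine (card_thresholdFunctions_le _).trans ?_
    simpa using hN (k + s + 1)
  · rw [Fintype.card_piFinset_const]
    have h := (card_thresholdFunctions_le (fun (y : Fin k → Bool) i => bit (y i))).trans (hN _)
    rw [Fintype.card_fin] at h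
    calc _ ≤ (2 ^ ((k + 1) * (k + 1))) ^ s * 2 ^ ((k + 1) * (k + s + 1)) := by gcongr
      _ = _ := by rw [← pow_mul, ← pow_add]; congr 1; ring

theorem card_depthTwoFunctions_pos (k s : ℕ) : 0 < (depthTwoFunctions k s).card := by
  classical
  refine card_pos.2 ⟨fun _ => true, ?_⟩
  rw [depthTwoFunctions]
  refine mem_biUnion.2 ⟨fun _ _ => true, Fintype.mem_piFinset.2 fun _ => ?_, ?_⟩ <;>
  exact mem_thresholdFunctions.2 ⟨fun _ => 0, 0, fun _ => by simp⟩

/-- Gates whose number is at most `s` may be indexed by any finite set. -/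
theorem mem_depthTwoFunctions {k s : ℕ} {β : Type*} (B : Finset β) (hB : B.card ≤ s)
    (g : β → (Fin k → Bool) → Bool)
    (hg : ∀ b ∈ B, g b ∈ thresholdFunctions (fun (y : Fin k → Bool) i => bit (y i)))
    (w : Fin k → ℝ) (v : β → ℝ) (θ : ℝ) (f : (Fin k → Bool) → Bool)
    (hf : ∀ y, f y = decide (θ ≤ ∑ i, w i * bit (y i) + ∑ b ∈ B, v b * bit (g b y))) :
    f ∈ depthTwoFunctions k s := by
  classical
  obtain ⟨e⟩ : Nonempty (B ↪ Fin s) :=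
    Function.Embedding.nonempty_of_card_le (by simpa using hB)
  rw [depthTwoFunctions]
  -- Unused slots are padded with the constant gate and given weight `0`.
  refine mem_biUnion.2 ⟨Function.extend e (fun b => g b) (fun _ _ => true),
    Fintype.mem_piFinset.2 fun j => ?_, mem_thresholdFunctions.2
      ⟨Sum.elim w (Function.extend e (fun b => v b) 0), θ, fun y => ?_⟩⟩
  · by_cases h : ∃ b, e b = j
    · obtain ⟨b, rfl⟩ := h
      rw [e.injective.extend_apply]
      exact hg b b.2
    · rw [Function.extend_apply' _ _ _ h]
      exact mem_thresholdFunctions.2 ⟨fun _ => 0, 0, fun _ => by simp⟩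
  · rw [hf, Fintype.sum_sum_type]
    simp only [Sum.elim_inl, Sum.elim_inr]
    rw [← sum_coe_sort B]
    congr 3
    refine sum_of_injOn e e.injective.injOn (by simp) (fun j _ hj => ?_) fun b _ => ?_
    · rw [Function.extend_apply' _ _ _ (by simpa using hj)]
      simp
    · rw [e.injective.extend_apply, e.injective.extend_apply]

/-! ### Averages over product spaces -/

theorem expect_prod_pi {κ V : Type*} [Fintype κ] [DecidableEq κ] [Fintype V] (F : κ → V → ℝ) :
    𝔼 Z : κ → V, ∏ i, F i (Z i) = ∏ i, 𝔼 v, F i v := by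
  simp_rw [Fintype.expect_eq_sum_div_card]
  rw [prod_div_distrib, prod_univ_sum, Fintype.piFinset_univ]
  simp

theorem expect_mul_pi {κ V : Type*} [Fintype κ] [DecidableEq κ] [Fintype V] [Nonempty V]
    (f g : V → ℝ) {i j : κ} (hij : i ≠ j) :
    𝔼 Z : κ → V, f (Z i) * g (Z j) = (𝔼 v, f v) * 𝔼 v, g v := by
  have h1 : ∀ Z : κ → V, f (Z i) * g (Z j) =
      ∏ l, (if l = i then f (Z l) else 1) * (if l = j then g (Z l) else 1) := by
    intro Z; rw [prod_mul_distrib]; simp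
  simp_rw [h1]
  rw [expect_prod_pi (fun l v => (if l = i then f v else 1) * (if l = j then g v else 1))]
  have h2 : ∀ l, (𝔼 v, (if l = i then f v else 1) * (if l = j then g v else 1)) =
      (if l = i then 𝔼 v, f v else 1) * (if l = j then 𝔼 v, g v else 1) := by
    intro l
    by_cases hi : l = i
    · have hj : l ≠ j := fun h => hij (hi ▸ h)
      subst hi
      simp [hj]
    · by_cases hj : l = j
      · subst hj; simp [hi]
      · simp [hi, hj]
  simp_rw [h2, prod_mul_distrib]
  simp

theorem expect_eval_pi {κ V : Type*} [Fintype κ] [DecidableEq κ] [Fintype V] [Nonempty V]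
    (f : V → ℝ) (i : κ) : 𝔼 Z : κ → V, f (Z i) = 𝔼 v, f v := by
  have h1 : ∀ Z : κ → V, f (Z i) = ∏ l, (if l = i then f (Z l) else 1) := by
    intro Z; simp
  simp_rw [h1]
  rw [expect_prod_pi (fun l v => (if l = i then f v else 1))]
  have h2 : ∀ l, (𝔼 v, (if l = i then f v else 1)) = (if l = i then 𝔼 v, f v else 1) := by
    intro l
    by_cases hi : l = i <;> simp [hi]
  simp_rw [h2]
  simp

/-! ### Moments of products of independent centred variables -/

section Moments

variable {κ V : Type*} [Fintype κ] [DecidableEq κ] [Fintype V] [Nonempty V]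
  {u : κ → V → ℝ} {t : κ → ℝ}

theorem expect_prod_one_add (h0 : ∀ i, 𝔼 v, u i v = 0) :
    𝔼 Z : κ → V, ∏ i, (1 + u i (Z i)) = 1 := by
  rw [expect_prod_pi (fun i v => 1 + u i v)]
  simp [expect_add_distrib, h0]

theorem expect_prod_one_add_sq (h0 : ∀ i, 𝔼 v, u i v = 0) (h2 : ∀ i, 𝔼 v, u i v ^ 2 = t i) :
    𝔼 Z : κ → V, (∏ i, (1 + u i (Z i))) ^ 2 = ∏ i, (1 + t i) := by
  simp_rw [← prod_pow]
  rw [expect_prod_pi (fun i v => (1 + u i v) ^ 2)]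
  refine prod_congr rfl fun i _ => ?_
  have : ∀ v, (1 + u i v) ^ 2 = 1 + 2 * u i v + u i v ^ 2 := fun v => by ring
  simp_rw [this, expect_add_distrib, ← mul_expect, h0, h2]
  simp

theorem expect_prod_one_add_mul (h0 : ∀ i, 𝔼 v, u i v = 0) (h2 : ∀ i, 𝔼 v, u i v ^ 2 = t i)
    (i : κ) : 𝔼 Z : κ → V, (∏ l, (1 + u l (Z l))) * u i (Z i) = t i := by
  have h1 : ∀ Z : κ → V, (∏ l, (1 + u l (Z l))) * u i (Z i) =
      ∏ l, (1 + u l (Z l)) * (if l = i then u l (Z l) else 1) := by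
    intro Z; rw [prod_mul_distrib]; simp
  simp_rw [h1]
  rw [expect_prod_pi (fun l v => (1 + u l v) * (if l = i then u l v else 1))]
  have h3 : ∀ l, (𝔼 v, (1 + u l v) * (if l = i then u l v else 1)) = if l = i then t l else 1 := by
    intro l
    by_cases hl : l = i
    · have : ∀ v, (1 + u l v) * u l v = u l v + u l v ^ 2 := fun v => by ring
      simp_rw [if_pos hl, this, expect_add_distrib, h0, h2, zero_add]
    · simp [hl, expect_add_distrib, h0]
  simp_rw [h3]
  simp

theorem expect_sum_sq (h0 : ∀ i, 𝔼 v, u i v = 0) (h2 : ∀ i, 𝔼 v, u i v ^ 2 = t i) :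
    𝔼 Z : κ → V, (∑ i, u i (Z i)) ^ 2 = ∑ i, t i := by
  simp_rw [sq, sum_mul_sum, expect_sum_comm]
  refine sum_congr rfl fun i _ => ?_
  rw [sum_eq_single i]
  · simp_rw [← sq]
    rw [expect_eval_pi (fun v => u i v ^ 2), h2]
  · intro j _ hj
    rw [expect_mul_pi (fun v => u i v) (fun v => u j v) hj.symm, h0, zero_mul]
  · simp

theorem expect_prod_sub_one_sq (h0 : ∀ i, 𝔼 v, u i v = 0) (h2 : ∀ i, 𝔼 v, u i v ^ 2 = t i) :
    𝔼 Z : κ → V, (∏ i, (1 + u i (Z i)) - 1) ^ 2 = ∏ i, (1 + t i) - 1 := by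
  have : ∀ Z : κ → V, (∏ i, (1 + u i (Z i)) - 1) ^ 2 =
      (∏ i, (1 + u i (Z i))) ^ 2 - 2 * ∏ i, (1 + u i (Z i)) + 1 := fun Z => by ring
  simp_rw [this, expect_add_distrib, expect_sub_distrib, ← mul_expect,
    expect_prod_one_add_sq h0 h2, expect_prod_one_add h0]
  simp
  ring

/-- In the expansion of the product, the monomials over distinct index sets are orthogonal, so
deleting degrees 0 and 1 deletes exactly `1` and `∑ t i` from the second moment. -/
theorem expect_prod_sub_one_sub_sum_sq (h0 : ∀ i, 𝔼 v, u i v = 0)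
    (h2 : ∀ i, 𝔼 v, u i v ^ 2 = t i) :
    𝔼 Z : κ → V, (∏ i, (1 + u i (Z i)) - 1 - ∑ i, u i (Z i)) ^ 2 =
      ∏ i, (1 + t i) - 1 - ∑ i, t i := by
  have : ∀ Z : κ → V, (∏ i, (1 + u i (Z i)) - 1 - ∑ i, u i (Z i)) ^ 2 =
      (∏ i, (1 + u i (Z i)) - 1) ^ 2 - 2 * (∑ i, (∏ l, (1 + u l (Z l))) * u i (Z i))
        + 2 * ∑ i, u i (Z i) + (∑ i, u i (Z i)) ^ 2 := fun Z => by
    rw [← mul_sum]; ring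
  simp_rw [this, expect_add_distrib, expect_sub_distrib, ← mul_expect, expect_sum_comm,
    expect_prod_one_add_mul h0 h2, expect_sum_sq h0 h2, expect_prod_sub_one_sq h0 h2]
  have h3 : ∀ i, 𝔼 Z : κ → V, u i (Z i) = 0 := fun i => by
    rw [expect_eval_pi (fun v => u i v), h0]
  simp_rw [h3]
  simp
  ring

end Moments

theorem expect_pm_beq (b : Bool) : 𝔼 a : Bool, pm (a == b) = 0 := by
  rw [Fintype.expect_eq_sum_div_card]
  cases b <;> simp [pm]

theorem pm_sq (b : Bool) : pm b ^ 2 = 1 := by cases b <;> simp [pm]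

theorem pm_beq_not (a b : Bool) : pm (a == !b) = -pm (a == b) := by
  cases a <;> cases b <;> simp [pm]

theorem expect_linear_form {ι : Type*} [Fintype ι] [DecidableEq ι] (c : ι → ℝ) (o : ι → Bool) :
    𝔼 v : ι → Bool, ∑ p, c p * pm (v p == o p) = 0 := by
  rw [expect_sum_comm]
  refine sum_eq_zero fun p _ => ?_
  rw [← mul_expect, expect_eval_pi (fun b => pm (b == o p)), expect_pm_beq, mul_zero]

theorem expect_linear_form_sq {ι : Type*} [Fintype ι] [DecidableEq ι] (c : ι → ℝ)
    (o : ι → Bool) :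
    𝔼 v : ι → Bool, (∑ p, c p * pm (v p == o p)) ^ 2 = ∑ p, c p ^ 2 := by
  refine expect_sum_sq (u := fun p b => c p * pm (b == o p)) (fun p => ?_) fun p => ?_
  · rw [← mul_expect, expect_pm_beq, mul_zero]
  · simp_rw [mul_pow, pm_sq, mul_one]
    exact Fintype.expect_const _

theorem expect_mul_le_sqrt {Ω : Type*} [Fintype Ω] [Nonempty Ω] (f G : Ω → ℝ)
    (hf : ∀ x, f x ^ 2 ≤ 1) : 𝔼 x, f x * G x ≤ √(𝔼 x, G x ^ 2) := by
  refine Real.le_sqrt_of_sq_le ((expect_mul_sq_le_sq_mul_sq univ f G).trans ?_)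
  have h1 : 𝔼 x, f x ^ 2 ≤ 1 := expect_le univ_nonempty fun x _ => hf x
  have h2 : 0 ≤ 𝔼 x, G x ^ 2 := expect_nonneg fun x _ => sq_nonneg _
  nlinarith

/-! ### Elementary estimates for products -/

theorem exp_four_le : Real.exp 4 ≤ 64 := by
  have h : Real.exp 4 = Real.exp 1 ^ 4 := by rw [← Real.exp_nat_mul]; norm_num
  have h1 := Real.exp_one_lt_d9
  have h2 := Real.exp_pos 1
  rw [h]
  calc Real.exp 1 ^ 4 ≤ 2.72 ^ 4 := by gcongr; linarith
    _ ≤ 64 := by norm_num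

theorem prod_one_add_sub_one_le {κ : Type*} [Fintype κ] {t : κ → ℝ} (ht : ∀ i, 0 ≤ t i)
    (h4 : ∑ i, t i ≤ 4) : ∏ i, (1 + t i) - 1 ≤ 64 * ∑ i, t i := by
  set T := ∑ i, t i with hT
  have hT0 : 0 ≤ T := sum_nonneg fun i _ => ht i
  have h1 : ∏ i, (1 + t i) ≤ Real.exp T := Real.prod_one_add_le_exp_sum _ fun i => ht i
  have h2 := Real.add_one_le_exp (-T)
  have h3 : Real.exp T * Real.exp (-T) = 1 := by rw [← Real.exp_add]; simp
  have h5 : Real.exp T ≤ 64 := (Real.exp_le_exp.2 h4).trans exp_four_le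
  have h6 := Real.exp_pos T
  nlinarith

theorem prod_one_add_sub_one_sub_sum_le {κ : Type*} [Fintype κ] {t : κ → ℝ} (ht : ∀ i, 0 ≤ t i)
    (h4 : ∑ i, t i ≤ 4) : ∏ i, (1 + t i) - 1 - ∑ i, t i ≤ 64 * (∑ i, t i) ^ 2 := by
  set T := ∑ i, t i with hT
  have hT0 : 0 ≤ T := sum_nonneg fun i _ => ht i
  have h1 : ∏ i, (1 + t i) ≤ Real.exp T := Real.prod_one_add_le_exp_sum _ fun i => ht i
  have h2 := Real.add_one_le_exp (-T)
  have h3 : Real.exp T * Real.exp (-T) = 1 := by rw [← Real.exp_add]; simp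
  have h5 : Real.exp T ≤ 64 := (Real.exp_le_exp.2 h4).trans exp_four_le
  have h6 := Real.exp_pos T
  have h7 : Real.exp T - 1 ≤ T * Real.exp T := by nlinarith
  have h8 : Real.exp T - 1 - T ≤ T * (T * Real.exp T) := by nlinarith
  have h9 : T * T * Real.exp T ≤ T * T * 64 := by gcongr
  nlinarith

/-! ### Random restrictions leaving one variable of each block alive -/

section Restriction

variable {k m : ℕ}

/-- Replace, in each block `i`, the bit at the live position `J i` by `y i`. -/
def override (z : Fin k × Fin m → Bool) (J : Fin k → Fin m) (y : Fin k → Bool) :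
    Fin k × Fin m → Bool :=
  fun p => if p.2 = J p.1 then y p.1 else z p

theorem expect_override (J : Fin k → Fin m) (φ : (Fin k × Fin m → Bool) → ℝ) :
    𝔼 z, 𝔼 y, φ (override z J y) = 𝔼 z, φ z := by
  -- Swapping `y` with the live bits of `z` permutes the pairs `(z, y)`, so the overridden input is
  -- uniform.
  have hinv : Function.Involutive fun q : (Fin k × Fin m → Bool) × (Fin k → Bool) =>
      (override q.1 J q.2, fun i => q.1 (i, J i)) := by
    rintro ⟨z, y⟩
    refine Prod.ext (funext fun p => ?_) (funext fun i => ?_)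
    · by_cases h : p.2 = J p.1
      · simp [override, ← h]
      · simp [override, h]
    · simp [override]
  have h := Fintype.expect_equiv hinv.toPerm (fun q => φ (override q.1 J q.2)) (fun q => φ q.1)
    fun q => rfl
  rw [← univ_product_univ, expect_product, expect_product] at h
  simpa using h

/-- The signed indicator of agreement with the orientation `o`, for coordinates in `D`. -/
noncomputable def agree (D : Finset (Fin k × Fin m)) (o z : Fin k × Fin m → Bool)
    (p : Fin k × Fin m) : ℝ :=
  if p ∈ D then pm (z p == o p) else 0

theorem agree_not (D : Finset (Fin k × Fin m)) (o z : Fin k × Fin m → Bool) (p : Fin k × Fin m) :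
    agree D (fun q => !o q) z p = -agree D o z p := by
  unfold agree
  split_ifs
  · exact pm_beq_not _ _
  · simp

/-- The product is the density of the uniform measure conditioned on agreement with `o` at the live
variables in `D`: each factor is `2` on agreement and `0` on disagreement. Live variables outside
`D` do not affect `f`. -/
theorem expect_comp_override {D : Finset (Fin k × Fin m)} {f : (Fin k × Fin m → Bool) → ℝ}
    (hf : ∀ z z', (∀ p ∈ D, z p = z' p) → f z = f z') (J : Fin k → Fin m)
    (o : Fin k × Fin m → Bool) :
    𝔼 z, f (override z J fun i => o (i, J i)) = 𝔼 z, f z * ∏ i, (1 + agree D o z (i, J i)) := by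
  rw [← expect_override J fun z => f z * ∏ i, (1 + agree D o z (i, J i))]
  refine expect_congr rfl fun z _ => ?_
  have h1 : ∀ y, f (override z J y) * ∏ i, (1 + agree D o (override z J y) (i, J i)) =
      f (override z J fun i => o (i, J i)) *
        ∏ i, (1 + if (i, J i) ∈ D then pm (y i == o (i, J i)) else 0) := by
    intro y
    have h2 : ∏ i, (1 + agree D o (override z J y) (i, J i)) =
        ∏ i, (1 + if (i, J i) ∈ D then pm (y i == o (i, J i)) else 0) := by
      simp [agree, override]
    rw [h2]
    by_cases h : ∀ i, (i, J i) ∈ D → y i = o (i, J i)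
    · congr 1
      refine hf _ _ fun p hp => ?_
      by_cases hpJ : p.2 = J p.1
      · have : (p.1, J p.1) = p := by rw [← hpJ]
        simp only [override, hpJ, if_true]
        exact h p.1 (this ▸ hp)
      · simp [override, hpJ]
    · push Not at h
      obtain ⟨i, hi, hne⟩ := h
      rw [prod_eq_zero (mem_univ i), mul_zero, mul_zero]
      have : (y i == o (i, J i)) = false := by simpa using hne
      simp [hi, this, pm]
  simp_rw [h1, ← mul_expect]
  rw [expect_prod_one_add (u := fun i b => if (i, J i) ∈ D then pm (b == o (i, J i)) else 0),
    mul_one]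
  intro i
  by_cases h : (i, J i) ∈ D
  · simp only [h, if_true]
    exact expect_pm_beq _
  · simp [h]

end Restriction

/-! ### Survival of a threshold gate: pointwise bounds and block means -/

section Gate

variable {k m : ℕ}

/-- The restricted function is non-constant and reads at least two live variables. -/
def Survives (D : Finset (Fin k × Fin m)) (f : (Fin k × Fin m → Bool) → Bool)
    (z : Fin k × Fin m → Bool) (J : Fin k → Fin m) : Prop :=
  2 ≤ (univ.filter fun i => (i, J i) ∈ D).card ∧
    ∃ y y', f (override z J y) ≠ f (override z J y')

/-- `1` if at least two of the live variables belong to `D`, else `0`. -/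
noncomputable def twoLive (D : Finset (Fin k × Fin m)) (J : Fin k → Fin m) : ℝ :=
  if 2 ≤ (univ.filter fun i => (i, J i) ∈ D).card then 1 else 0

theorem bit_sq_le (b : Bool) : bit b ^ 2 ≤ 1 := by cases b <;> simp [bit]

theorem bit_mono {a b : Bool} (h : a = true → b = true) : bit a ≤ bit b := by
  cases a <;> cases b <;> simp_all [bit]

/-- Setting each live bit according to the sign of its weight maximizes the weighted sum; the
opposite setting minimizes it. -/
theorem eval_override_max {f : (Fin k × Fin m → Bool) → Bool} {w : Fin k × Fin m → ℝ} {θ : ℝ}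
    (hf : ∀ z, f z = decide (θ ≤ ∑ p, w p * bit (z p))) {z : Fin k × Fin m → Bool}
    {J : Fin k → Fin m} (y : Fin k → Bool) :
    f (override z J y) = true → f (override z J fun i => decide (0 ≤ w (i, J i))) = true := by
  rw [hf, hf, decide_eq_true_iff, decide_eq_true_iff]
  refine fun h => h.trans (sum_le_sum fun p _ => ?_)
  by_cases hp : p.2 = J p.1
  · have hp' : (p.1, J p.1) = p := by rw [← hp]
    simp only [override, hp, if_true, hp']
    by_cases h0 : 0 ≤ w p <;> cases y p.1 <;> (simp [bit, h0]; try linarith)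
  · simp [override, hp]

theorem eval_override_min {f : (Fin k × Fin m → Bool) → Bool} {w : Fin k × Fin m → ℝ} {θ : ℝ}
    (hf : ∀ z, f z = decide (θ ≤ ∑ p, w p * bit (z p))) {z : Fin k × Fin m → Bool}
    {J : Fin k → Fin m} (y : Fin k → Bool) :
    f (override z J fun i => !decide (0 ≤ w (i, J i))) = true → f (override z J y) = true := by
  rw [hf, hf, decide_eq_true_iff, decide_eq_true_iff]
  refine fun h => h.trans (sum_le_sum fun p _ => ?_)
  by_cases hp : p.2 = J p.1
  · have hp' : (p.1, J p.1) = p := by rw [← hp]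
    simp only [override, hp, if_true, hp']
    by_cases h0 : 0 ≤ w p <;> cases y p.1 <;> (simp [bit, h0]; try linarith)
  · simp [override, hp]

open Classical in
theorem survives_le {D : Finset (Fin k × Fin m)} {f : (Fin k × Fin m → Bool) → Bool}
    {w : Fin k × Fin m → ℝ} {θ : ℝ} (hf : ∀ z, f z = decide (θ ≤ ∑ p, w p * bit (z p)))
    (z : Fin k × Fin m → Bool) (J : Fin k → Fin m) :
    (if Survives D f z J then (1 : ℝ) else 0) ≤
      twoLive D J * (bit (f (override z J fun i => decide (0 ≤ w (i, J i)))) -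
        bit (f (override z J fun i => !decide (0 ≤ w (i, J i))))) := by
  by_cases hS : Survives D f z J
  · obtain ⟨h2, y, y', hne⟩ := hS
    rw [if_pos ⟨h2, y, y', hne⟩, twoLive, if_pos h2]
    have h1 : f (override z J fun i => decide (0 ≤ w (i, J i))) = true := by
      by_contra h
      exact hne (by rw [Bool.eq_false_iff.2 (mt (eval_override_max hf y) h),
        Bool.eq_false_iff.2 (mt (eval_override_max hf y') h)])
    have h0 : f (override z J fun i => !decide (0 ≤ w (i, J i))) = false := by
      by_contra h
      rw [Bool.not_eq_false] at h
      exact hne (by rw [eval_override_min hf y h, eval_override_min hf y' h])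
    rw [h1, h0]
    simp [bit]
  · rw [if_neg hS]
    exact mul_nonneg (by unfold twoLive; split_ifs <;> simp)
      (sub_nonneg.2 (bit_mono (eval_override_min hf _)))

theorem twoLive_mem (D : Finset (Fin k × Fin m)) (J : Fin k → Fin m) :
    0 ≤ twoLive D J ∧ twoLive D J ≤ 1 := by
  unfold twoLive; split_ifs <;> simp

/-- The mean of the signed agreement over the block `i`. -/
noncomputable def blockMean (D : Finset (Fin k × Fin m)) (o z : Fin k × Fin m → Bool)
    (i : Fin k) : ℝ :=
  𝔼 j, agree D o z (i, j)

theorem blockMean_not (D : Finset (Fin k × Fin m)) (o z : Fin k × Fin m → Bool) (i : Fin k) :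
    blockMean D (fun q => !o q) z i = -blockMean D o z i := by
  simp_rw [blockMean, agree_not, expect_neg_distrib]

theorem expect_prod_agree [NeZero m] (D : Finset (Fin k × Fin m)) (o z : Fin k × Fin m → Bool) :
    𝔼 J : Fin k → Fin m, ∏ i, (1 + agree D o z (i, J i)) = ∏ i, (1 + blockMean D o z i) := by
  rw [expect_prod_pi (fun i j => 1 + agree D o z (i, j))]
  simp [expect_add_distrib, blockMean]

theorem expect_sum_agree [NeZero m] (D : Finset (Fin k × Fin m)) (o z : Fin k × Fin m → Bool) :
    𝔼 J : Fin k → Fin m, ∑ i, agree D o z (i, J i) = ∑ i, blockMean D o z i := by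
  rw [expect_sum_comm]
  exact sum_congr rfl fun i _ => expect_eval_pi (fun j => agree D o z (i, j)) i

theorem sum_sq_indicator (D : Finset (Fin k × Fin m)) (a : ℝ) :
    ∑ p, (if p ∈ D then a else 0) ^ 2 = D.card * a ^ 2 := by
  simp [ite_pow]

/-- The block means are independent centred sign sums whose variances add up to `|D| / m ^ 2`, so
the moment identities for products apply. -/
theorem expect_blockMean_moments [NeZero m] (D : Finset (Fin k × Fin m))
    (o : Fin k × Fin m → Bool) (hD : (D.card : ℝ) / m ^ 2 ≤ 4) :
    𝔼 z, (∏ i, (1 + blockMean D o z i) - 1) ^ 2 ≤ 64 * ((D.card : ℝ) / m ^ 2) ∧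
    𝔼 z, (∏ i, (1 + blockMean D o z i) - 1 - ∑ i, blockMean D o z i) ^ 2 ≤
      64 * ((D.card : ℝ) / m ^ 2) ^ 2 := by
  set c : Fin k × Fin m → ℝ := fun p => if p ∈ D then (1 / m : ℝ) else 0 with hc
  set u : Fin k → (Fin m → Bool) → ℝ := fun i v => ∑ j, c (i, j) * pm (v j == o (i, j)) with hu
  set t : Fin k → ℝ := fun i => ∑ j, c (i, j) ^ 2 with ht
  have hsum : ∑ i, t i = (D.card : ℝ) / m ^ 2 := by
    rw [ht, ← Fintype.sum_prod_type (fun p => c p ^ 2), hc, sum_sq_indicator]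
    ring
  have hbm : ∀ z i, blockMean D o z i = u i (fun j => z (i, j)) := by
    intro z i
    rw [blockMean, Fintype.expect_eq_sum_div_card, sum_div]
    refine sum_congr rfl fun j _ => ?_
    rw [hc, agree, Fintype.card_fin]
    by_cases h : (i, j) ∈ D
    · simp only [h, if_true]; ring
    · simp [h]
  have h0 : ∀ i, 𝔼 v, u i v = 0 := fun i => expect_linear_form _ _
  have h2 : ∀ i, 𝔼 v, u i v ^ 2 = t i := fun i => expect_linear_form_sq _ _
  have htn : ∀ i, 0 ≤ t i := fun i => sum_nonneg fun j _ => sq_nonneg _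
  have hcurry : ∀ φ : (Fin k → ℝ) → ℝ, 𝔼 z, φ (blockMean D o z) =
      𝔼 Z : Fin k → Fin m → Bool, φ fun i => u i (Z i) := by
    intro φ
    refine Fintype.expect_equiv (Equiv.curry _ _ _) _ _ fun z => ?_
    congr 1
    funext i
    exact hbm z i
  constructor
  · rw [hcurry (fun b => (∏ i, (1 + b i) - 1) ^ 2), expect_prod_sub_one_sq h0 h2, ← hsum]
    exact prod_one_add_sub_one_le htn (hsum ▸ hD)
  · rw [hcurry (fun b => (∏ i, (1 + b i) - 1 - ∑ i, b i) ^ 2),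
      expect_prod_sub_one_sub_sum_sq h0 h2, ← hsum]
    exact prod_one_add_sub_one_sub_sum_le htn (hsum ▸ hD)

/-- The probability that `p` is live together with another live variable of `D`. -/
noncomputable def pairProb (D : Finset (Fin k × Fin m)) (p : Fin k × Fin m) : ℝ :=
  𝔼 J : Fin k → Fin m, twoLive D J * (if J p.1 = p.2 then 1 else 0)

theorem pairProb_nonneg (D : Finset (Fin k × Fin m)) (p : Fin k × Fin m) : 0 ≤ pairProb D p :=
  expect_nonneg fun J _ => mul_nonneg (twoLive_mem D J).1 (by split_ifs <;> simp)

/-- Union bound over the second live variable `r ∈ D`: it lies in another block, so it is live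
together with `p` with probability `1 / m ^ 2`. -/
theorem pairProb_le [NeZero m] (D : Finset (Fin k × Fin m)) (p : Fin k × Fin m) :
    pairProb D p ≤ D.card / m ^ 2 := by
  have hpt : ∀ J : Fin k → Fin m, twoLive D J * (if J p.1 = p.2 then 1 else 0) ≤
      ∑ r ∈ D.filter (fun r => r.1 ≠ p.1),
        (if J p.1 = p.2 then (1 : ℝ) else 0) * (if J r.1 = r.2 then 1 else 0) := by
    intro J
    have hnn : ∀ r ∈ D.filter (fun r => r.1 ≠ p.1),
        0 ≤ (if J p.1 = p.2 then (1 : ℝ) else 0) * (if J r.1 = r.2 then 1 else 0) := by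
      intro r _; split_ifs <;> simp
    unfold twoLive
    by_cases h : 2 ≤ (univ.filter fun i => (i, J i) ∈ D).card
    · by_cases hp : J p.1 = p.2
      · obtain ⟨i, hi, hne⟩ := exists_mem_ne (show 1 < _ from h) p.1
        have := single_le_sum hnn (a := (i, J i)) (by simpa [hne] using hi)
        simpa [h, hp] using this
      · simp [hp]
    · rw [if_neg h, zero_mul]
      exact sum_nonneg hnn
  have hE : ∀ r ∈ D.filter (fun r => r.1 ≠ p.1), 𝔼 J : Fin k → Fin m,
      (if J p.1 = p.2 then (1 : ℝ) else 0) * (if J r.1 = r.2 then 1 else 0) = 1 / m ^ 2 := by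
    intro r hr
    rw [expect_mul_pi (fun j => if j = p.2 then (1 : ℝ) else 0) (fun j => if j = r.2 then 1 else 0)
      (mem_filter.1 hr).2.symm]
    simp_rw [Fintype.expect_eq_sum_div_card]
    simp
    ring
  calc pairProb D p ≤ _ := expect_le_expect fun J _ => hpt J
    _ = ∑ r ∈ D.filter (fun r => r.1 ≠ p.1), (1 / m ^ 2 : ℝ) := by
      rw [expect_sum_comm]; exact sum_congr rfl hE
    _ = (D.filter (fun r => r.1 ≠ p.1)).card / m ^ 2 := by simp [div_eq_mul_inv]
    _ ≤ _ := by gcongr; exact filter_subset _ _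

theorem expect_twoLive_mul_sum_agree [NeZero m] (D : Finset (Fin k × Fin m))
    (o z : Fin k × Fin m → Bool) :
    𝔼 J : Fin k → Fin m, twoLive D J * ∑ i, agree D o z (i, J i) =
      ∑ p, (if p ∈ D then pairProb D p else 0) * pm (z p == o p) := by
  have h1 : ∀ J : Fin k → Fin m, twoLive D J * ∑ i, agree D o z (i, J i) =
      ∑ p : Fin k × Fin m, twoLive D J * (if J p.1 = p.2 then 1 else 0) * agree D o z p := by
    intro J
    rw [Fintype.sum_prod_type, mul_sum]
    refine sum_congr rfl fun i _ => ?_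
    simp
  simp_rw [h1, expect_sum_comm, ← expect_mul]
  refine sum_congr rfl fun p _ => ?_
  change pairProb D p * agree D o z p = _
  unfold agree
  split_ifs <;> simp

/-- The difference of products minus its linear part vanishes when at most one live variable is in
`D`, so the indicator `twoLive` can be dropped there. It survives only on the linear part, where
`pairProb` makes the coefficients small. -/
theorem twoLive_mul_prod_sub (D : Finset (Fin k × Fin m)) (o z : Fin k × Fin m → Bool)
    (J : Fin k → Fin m) :
    twoLive D J * (∏ i, (1 + agree D o z (i, J i)) - ∏ i, (1 - agree D o z (i, J i))) =
      ∏ i, (1 + agree D o z (i, J i)) - ∏ i, (1 - agree D o z (i, J i))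
        - 2 * ∑ i, agree D o z (i, J i) + 2 * (twoLive D J * ∑ i, agree D o z (i, J i)) := by
  by_cases h : 2 ≤ (univ.filter fun i => (i, J i) ∈ D).card
  · simp only [twoLive, if_pos h]; ring
  · have h0 : ∏ i, (1 + agree D o z (i, J i)) - ∏ i, (1 - agree D o z (i, J i))
        - 2 * ∑ i, agree D o z (i, J i) = 0 := by
      by_cases hex : ∃ i, (i, J i) ∈ D
      · obtain ⟨i, hi⟩ := hex
        have hz : ∀ l, l ≠ i → agree D o z (l, J l) = 0 := by
          intro l hl
          rw [agree, if_neg]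
          intro hlD
          exact h (one_lt_card.2 ⟨l, by simpa using hlD, i, by simpa using hi, hl⟩)
        rw [Fintype.prod_eq_single i fun l hl => by rw [hz l hl, add_zero],
          Fintype.prod_eq_single i fun l hl => by rw [hz l hl, sub_zero],
          Fintype.sum_eq_single i hz]
        ring
      · push Not at hex
        simp [agree, hex]
    rw [h0]
    simp [twoLive, if_neg h]

end Gate

/-! ### Survival probability of a threshold gate -/

section GateProbability

variable {k m : ℕ}

/-- The probability that a random restriction leaves the function non-constant with at least two
live inputs. -/
noncomputable def survivalProb (D : Finset (Fin k × Fin m))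
    (f : (Fin k × Fin m → Bool) → Bool) : ℝ := by
  classical exact 𝔼 J : Fin k → Fin m, 𝔼 z, if Survives D f z J then (1 : ℝ) else 0

variable {D : Finset (Fin k × Fin m)} {f : (Fin k × Fin m → Bool) → Bool}
  {w : Fin k × Fin m → ℝ} {θ : ℝ}

theorem eq_of_eq_on_support (hf : ∀ z, f z = decide (θ ≤ ∑ p, w p * bit (z p)))
    (hw : ∀ p, p ∉ D → w p = 0) (z z' : Fin k × Fin m → Bool) (h : ∀ p ∈ D, z p = z' p) :
    f z = f z' := by
  have : ∑ p, w p * bit (z p) = ∑ p, w p * bit (z' p) := by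
    refine sum_congr rfl fun p _ => ?_
    by_cases hp : p ∈ D
    · rw [h p hp]
    · rw [hw p hp, zero_mul, zero_mul]
  rw [hf, hf, this]

theorem expect_max_sub_min (hf : ∀ z, f z = decide (θ ≤ ∑ p, w p * bit (z p)))
    (hw : ∀ p, p ∉ D → w p = 0) (J : Fin k → Fin m) :
    𝔼 z, (bit (f (override z J fun i => decide (0 ≤ w (i, J i)))) -
        bit (f (override z J fun i => !decide (0 ≤ w (i, J i))))) =
      𝔼 z, bit (f z) * (∏ i, (1 + agree D (fun p => decide (0 ≤ w p)) z (i, J i)) -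
        ∏ i, (1 - agree D (fun p => decide (0 ≤ w p)) z (i, J i))) := by
  have hdep : ∀ z z', (∀ p ∈ D, z p = z' p) → bit (f z) = bit (f z') := fun z z' h => by
    rw [eq_of_eq_on_support hf hw z z' h]
  have h1 := expect_comp_override hdep J fun p => decide (0 ≤ w p)
  have h2 := expect_comp_override hdep J fun p => !decide (0 ≤ w p)
  simp only [agree_not D (fun p => decide (0 ≤ w p)), ← sub_eq_add_neg] at h2
  simp_rw [mul_sub]
  rw [expect_sub_distrib, expect_sub_distrib, h1, h2]

variable [NeZero m]

theorem expect_bit_mul_prod_le (f : (Fin k × Fin m → Bool) → Bool) (o : Fin k × Fin m → Bool)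
    (hD : (D.card : ℝ) / m ^ 2 ≤ 4) :
    𝔼 z, bit (f z) * (∏ i, (1 + blockMean D o z i) - ∏ i, (1 - blockMean D o z i)) ≤
      16 * √((D.card : ℝ) / m ^ 2) ∧
    𝔼 z, bit (f z) * (∏ i, (1 + blockMean D o z i) - ∏ i, (1 - blockMean D o z i)
        - 2 * ∑ i, blockMean D o z i) ≤ 16 * ((D.card : ℝ) / m ^ 2) := by
  set T : ℝ := (D.card : ℝ) / m ^ 2 with hT
  have hT0 : 0 ≤ T := by positivity
  have hp := expect_blockMean_moments D o hD
  have hn := expect_blockMean_moments D (fun p => !o p) hD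
  simp only [blockMean_not, ← sub_eq_add_neg, sum_neg_distrib] at hn
  have hsq : ∀ b, bit b ^ 2 ≤ 1 ∧ (-bit b) ^ 2 ≤ 1 := fun b => by
    rw [neg_sq]; exact ⟨bit_sq_le b, bit_sq_le b⟩
  have s1 : √(64 * T) = 8 * √T := by
    rw [Real.sqrt_mul (by norm_num), show (64 : ℝ) = 8 ^ 2 by norm_num,
      Real.sqrt_sq (by norm_num)]
  have s2 : √(64 * T ^ 2) = 8 * T := by
    rw [show 64 * T ^ 2 = (8 * T) ^ 2 by ring, Real.sqrt_sq (by positivity)]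
  constructor
  · have a1 := (expect_mul_le_sqrt (fun z => bit (f z)) _ fun z => (hsq _).1).trans
      (Real.sqrt_le_sqrt hp.1)
    have a2 := (expect_mul_le_sqrt (fun z => -bit (f z)) _ fun z => (hsq _).2).trans
      (Real.sqrt_le_sqrt hn.1)
    rw [s1] at a1 a2
    refine le_trans (le_of_eq ?_) (add_le_add a1 a2 |>.trans_eq (by ring))
    rw [← expect_add_distrib]
    exact expect_congr rfl fun z _ => by ring
  · have a1 := (expect_mul_le_sqrt (fun z => bit (f z)) _ fun z => (hsq _).1).trans
      (Real.sqrt_le_sqrt hp.2)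
    have a2 := (expect_mul_le_sqrt (fun z => -bit (f z)) _ fun z => (hsq _).2).trans
      (Real.sqrt_le_sqrt hn.2)
    rw [s2] at a1 a2
    refine le_trans (le_of_eq ?_) (add_le_add a1 a2 |>.trans_eq (by ring))
    rw [← expect_add_distrib]
    exact expect_congr rfl fun z _ => by ring

theorem survivalProb_le_sqrt (hf : ∀ z, f z = decide (θ ≤ ∑ p, w p * bit (z p)))
    (hw : ∀ p, p ∉ D → w p = 0) (hD : (D.card : ℝ) / m ^ 2 ≤ 4) :
    survivalProb D f ≤ 16 * √((D.card : ℝ) / m ^ 2) := by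
  refine le_trans ?_ (expect_bit_mul_prod_le f (fun p => decide (0 ≤ w p)) hD).1
  -- Products of block means are unfolded into averages over `J`, so that the comparison can be made
  -- for each `J` separately.
  simp_rw [← expect_prod_agree, sub_eq_add_neg, ← blockMean_not, ← expect_prod_agree, agree_not,
    ← sub_eq_add_neg, ← expect_sub_distrib, mul_expect]
  rw [expect_comm]
  refine expect_le_expect fun J _ => ?_
  rw [← expect_max_sub_min hf hw]
  refine expect_le_expect fun z _ => (survives_le hf z J).trans ?_
  exact mul_le_of_le_one_left (sub_nonneg.2 (bit_mono (eval_override_min hf _))) (twoLive_mem D J).2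

/-- The first term is the part of degree at least two. The second is Cauchy–Schwarz for a linear
form with `|D|` coefficients, each at most `|D| / m ^ 2`. -/
theorem survivalProb_le_add (hf : ∀ z, f z = decide (θ ≤ ∑ p, w p * bit (z p)))
    (hw : ∀ p, p ∉ D → w p = 0) (hD : (D.card : ℝ) / m ^ 2 ≤ 4) :
    survivalProb D f ≤ 16 * ((D.card : ℝ) / m ^ 2) +
      2 * √((D.card : ℝ) * ((D.card : ℝ) / m ^ 2) ^ 2) := by
  set o : Fin k × Fin m → Bool := fun p => decide (0 ≤ w p) with ho
  have hlin : 𝔼 z, bit (f z) * ∑ p, (if p ∈ D then pairProb D p else 0) * pm (z p == o p) ≤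
      √((D.card : ℝ) * ((D.card : ℝ) / m ^ 2) ^ 2) := by
    refine (expect_mul_le_sqrt (fun z => bit (f z)) _ fun z => bit_sq_le _).trans
      (Real.sqrt_le_sqrt ?_)
    rw [expect_linear_form_sq, ← sum_sq_indicator]
    refine sum_le_sum fun p _ => ?_
    split_ifs
    · exact pow_le_pow_left₀ (pairProb_nonneg D p) (pairProb_le D p) 2
    · simp
  refine le_trans ?_ (add_le_add (expect_bit_mul_prod_le f o hD).2
    (mul_le_mul_of_nonneg_left hlin zero_le_two))
  rw [mul_expect, ← expect_add_distrib]
  have hJ : ∀ z, bit (f z) * (∏ i, (1 + blockMean D o z i) - ∏ i, (1 - blockMean D o z i)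
        - 2 * ∑ i, blockMean D o z i) + 2 * (bit (f z) *
          ∑ p, (if p ∈ D then pairProb D p else 0) * pm (z p == o p)) =
      𝔼 J : Fin k → Fin m, bit (f z) * (twoLive D J * (∏ i, (1 + agree D o z (i, J i)) -
        ∏ i, (1 - agree D o z (i, J i)))) := by
    intro z
    simp_rw [twoLive_mul_prod_sub]
    rw [← mul_expect, expect_add_distrib, ← mul_expect, expect_twoLive_mul_sum_agree,
      expect_sub_distrib, ← mul_expect, expect_sum_agree, expect_sub_distrib, expect_prod_agree]
    have := expect_prod_agree D (fun p => !o p) z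
    simp only [agree_not, blockMean_not, ← sub_eq_add_neg] at this
    rw [this]
    ring
  simp_rw [hJ]
  rw [expect_comm]
  refine expect_le_expect fun J _ => ?_
  refine (expect_le_expect fun z _ => survives_le hf z J).trans_eq ?_
  rw [← mul_expect, expect_max_sub_min hf hw, mul_expect]
  exact expect_congr rfl fun z _ => by ring

/-- The two bounds cross at `|D| = m`: below it `survivalProb_le_add` is used, above it
`survivalProb_le_sqrt`. -/
theorem survivalProb_le_card (hf : ∀ z, f z = decide (θ ≤ ∑ p, w p * bit (z p)))
    (hw : ∀ p, p ∉ D → w p = 0) (hD : (D.card : ℝ) / m ^ 2 ≤ 4) :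
    survivalProb D f ≤ 18 * (D.card / (m * √m)) := by
  have hm : (1 : ℝ) ≤ m := by exact_mod_cast Nat.one_le_iff_ne_zero.2 (NeZero.ne m)
  have hm0 : (0 : ℝ) < m := by linarith
  set r := √(m : ℝ) with hr
  have hr1 : 1 ≤ r := Real.one_le_sqrt.2 hm
  have hrm : r * r = m := Real.mul_self_sqrt hm0.le
  set q := √(D.card : ℝ) with hq
  have hq0 : 0 ≤ q := Real.sqrt_nonneg _
  have hqd : q * q = D.card := Real.mul_self_sqrt (by positivity)
  rw [← hqd] at hD ⊢
  have hr0 : 0 < r := by linarith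
  rcases le_total q r with h | h
  · have h1 := survivalProb_le_add hf hw (hqd ▸ hD)
    rw [← hqd, show q * q * (q * q / (m : ℝ) ^ 2) ^ 2 = (q * (q * q / (m : ℝ) ^ 2)) ^ 2 by ring,
      Real.sqrt_sq (by positivity)] at h1
    refine h1.trans ?_
    rw [← hrm]
    have h2 : q * q / (r * r) ^ 2 ≤ q * q / (r * r * r) := by
      rw [div_le_div_iff₀ (by positivity) (by positivity)]
      have : r ^ 3 ≤ r ^ 4 := pow_le_pow_right₀ hr1 (by norm_num)
      have := mul_le_mul_of_nonneg_left this (mul_nonneg hq0 hq0)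
      nlinarith
    have h3 : q * (q * q / (r * r) ^ 2) ≤ q * q / (r * r * r) := by
      calc _ ≤ r * (q * q / (r * r) ^ 2) := by gcongr
        _ = _ := by field_simp
    linarith
  · have h1 := survivalProb_le_sqrt hf hw (hqd ▸ hD)
    rw [← hqd, show q * q / (m : ℝ) ^ 2 = (q / m) ^ 2 by ring, Real.sqrt_sq (by positivity)] at h1
    have h2 : q / m ≤ q * q / (m * r) := by
      rw [div_le_div_iff₀ (by positivity) (by positivity)]
      have := mul_le_mul_of_nonneg_left h (mul_nonneg hq0 hm0.le)
      nlinarith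
    have h3 : 0 ≤ q * q / (m * r) := by positivity
    linarith

end GateProbability

/-! ### Correlation with a random function -/

theorem exp_expect_le {Ω : Type*} [Fintype Ω] [Nonempty Ω] (t : Ω → ℝ) :
    Real.exp (𝔼 x, t x) ≤ 𝔼 x, Real.exp (t x) := by
  set c := 𝔼 x, t x with hc
  have h : ∀ x, Real.exp c * (1 + t x - c) ≤ Real.exp (t x) := by
    intro x
    have h1 : Real.exp (t x) = Real.exp c * Real.exp (t x - c) := by
      rw [← Real.exp_add]; congr 1; ring
    rw [h1]
    gcongr
    linarith [Real.add_one_le_exp (t x - c)]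
  refine le_trans (le_of_eq ?_) (expect_le_expect fun x _ => h x)
  rw [← mul_expect, expect_sub_distrib, expect_add_distrib, ← hc]
  simp

theorem expect_exp_mul_pm_le (l a : ℝ) (ha : a ^ 2 = 1) :
    𝔼 b : Bool, Real.exp (l * (a * pm b)) ≤ Real.exp (l ^ 2 / 2) := by
  have h : 𝔼 b : Bool, Real.exp (l * (a * pm b)) = Real.cosh (l * a) := by
    rw [Fintype.expect_eq_sum_div_card, Real.cosh_eq]
    simp [pm]
  rw [h]
  refine (Real.cosh_le_exp_half_sq _).trans_eq ?_
  rw [mul_pow, ha, mul_one]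

section Correlation

variable {P : Type*} [Fintype P] [DecidableEq P]

theorem expect_exp_correlation_le (R : Finset P) (g : P → Bool) (l : ℝ) :
    𝔼 x : P → Bool, Real.exp (l * ∑ p ∈ R, pm (g p) * pm (x p)) ≤
      Real.exp (l ^ 2 * R.card / 2) := by
  have h1 : ∀ x : P → Bool, Real.exp (l * ∑ p ∈ R, pm (g p) * pm (x p)) =
      ∏ p, if p ∈ R then Real.exp (l * (pm (g p) * pm (x p))) else 1 := by
    intro x
    rw [mul_sum, Real.exp_sum]
    simp
  simp_rw [h1]
  rw [expect_prod_pi (fun p b => if p ∈ R then Real.exp (l * (pm (g p) * pm b)) else 1)]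
  calc _ ≤ ∏ p, (if p ∈ R then Real.exp (l ^ 2 / 2) else 1) := by
        refine prod_le_prod (fun p _ => expect_nonneg fun b _ => ?_) fun p _ => ?_
        · split_ifs <;> positivity
        · split_ifs
          · exact expect_exp_mul_pm_le _ _ (pm_sq _)
          · simp
    _ = _ := by
      rw [prod_ite_mem, univ_inter, prod_const, ← Real.exp_nat_mul]
      congr 1
      ring

theorem expect_mul_pm_eq_zero (φ : (P → Bool) → ℝ) (p : P)
    (hφ : ∀ x b, φ (Function.update x p b) = φ x) : 𝔼 x : P → Bool, φ x * pm (x p) = 0 := by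
  have hinv : Function.Involutive fun x : P → Bool => Function.update x p (!x p) := by
    intro x; simp
  have h := Fintype.expect_equiv hinv.toPerm (fun x => φ x * pm (x p))
    (fun x => -(φ x * pm (x p))) fun x => by
      simp only [Function.Involutive.coe_toPerm, hφ, Function.update_self]
      cases x p <;> simp [pm]
  rw [expect_neg_distrib] at h
  linarith

open Classical in
/-- If `F x` depends only on the coordinates of `x` in `R` and usually belongs to the class `A`,
then on average it has small correlation with `x`. -/
theorem correlation_le {Y : Type*} (σ : Y ≃ P) (F : (P → Bool) → Y → Bool) (R : Finset P)
    (hF : ∀ x x', (∀ p ∈ R, x p = x' p) → F x = F x') (A : Finset (Y → Bool)) (hA : A.Nonempty)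
    {l : ℝ} (hl : 0 < l) :
    l * 𝔼 x, ∑ p, pm (F x (σ.symm p)) * pm (x p) ≤
      2 * l * Fintype.card P * (𝔼 x, if F x ∈ A then (0 : ℝ) else 1) + Real.log A.card +
        l ^ 2 * R.card / 2 := by
  obtain ⟨g₀, hg₀⟩ := hA
  have hA0 : (0 : ℝ) < A.card := by exact_mod_cast card_pos.2 ⟨g₀, hg₀⟩
  -- For `p ∉ R`, flipping `x p` leaves `F x` unchanged and negates the term, so its mean is zero.
  have hR : 𝔼 x, ∑ p, pm (F x (σ.symm p)) * pm (x p) =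
      𝔼 x, ∑ p ∈ R, pm (F x (σ.symm p)) * pm (x p) := by
    rw [expect_sum_comm, expect_sum_comm]
    refine (sum_subset (subset_univ R) fun p _ hp => ?_).symm
    refine expect_mul_pm_eq_zero (fun x => pm (F x (σ.symm p))) p fun x b => ?_
    rw [hF (Function.update x p b) x fun q hq =>
      Function.update_of_ne (by rintro rfl; exact hp hq) _ _]
  -- Replacing `F x` by a fixed member of `A` on the bad event costs at most `2 * |P|` there.
  set G : (P → Bool) → Y → Bool := fun x => if F x ∈ A then F x else g₀ with hG
  have hGA : ∀ x, G x ∈ A := by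
    intro x; simp only [hG]; split_ifs with h
    · exact h
    · exact hg₀
  have habs : ∀ a b, |pm a * pm b| ≤ 1 := by
    intro a b; cases a <;> cases b <;> simp [pm]
  have hFG : ∀ x, ∑ p ∈ R, pm (F x (σ.symm p)) * pm (x p) ≤
      2 * Fintype.card P * (if F x ∈ A then (0 : ℝ) else 1) +
        ∑ p ∈ R, pm (G x (σ.symm p)) * pm (x p) := by
    intro x
    by_cases h : F x ∈ A
    · simp [hG, h]
    · have hb : ∀ H : Y → Bool, |∑ p ∈ R, pm (H (σ.symm p)) * pm (x p)| ≤ Fintype.card P := by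
        intro H
        refine (abs_sum_le_sum_abs _ _).trans ((sum_le_sum fun p _ => habs _ _).trans ?_)
        simpa using card_le_univ R
      have h1 := abs_le.1 (hb (F x))
      have h2 := abs_le.1 (hb (G x))
      rw [if_neg h]
      linarith [h1.2, h2.1]
  -- Jensen's inequality, then the exponential for `G x` is bounded by the sum over all of `A`. This
  -- removes the dependence of the function on `x`.
  have hE : l * 𝔼 x, ∑ p ∈ R, pm (G x (σ.symm p)) * pm (x p) ≤
      Real.log A.card + l ^ 2 * R.card / 2 := by
    rw [← Real.exp_le_exp, Real.exp_add, Real.exp_log hA0, mul_expect]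
    refine (exp_expect_le _).trans ?_
    calc _ ≤ 𝔼 x : P → Bool, ∑ g ∈ A,
            Real.exp (l * ∑ p ∈ R, pm (g (σ.symm p)) * pm (x p)) :=
          expect_le_expect fun x _ => single_le_sum
            (f := fun g => Real.exp (l * ∑ p ∈ R, pm (g (σ.symm p)) * pm (x p)))
            (fun g _ => (Real.exp_pos _).le) (hGA x)
      _ = ∑ g ∈ A, 𝔼 x : P → Bool,
            Real.exp (l * ∑ p ∈ R, pm (g (σ.symm p)) * pm (x p)) := expect_sum_comm _ _ _
      _ ≤ ∑ g ∈ A, Real.exp (l ^ 2 * R.card / 2) :=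
          sum_le_sum fun g _ => expect_exp_correlation_le R (fun p => g (σ.symm p)) l
      _ = _ := by simp
  rw [hR]
  have h1 := expect_le_expect (s := univ) fun x _ => hFG x
  rw [expect_add_distrib, ← mul_expect] at h1
  nlinarith [mul_le_mul_of_nonneg_left h1 hl.le]

end Correlation

/-! ### Restricting circuits -/

/-- Real functions of `k` bits that are affine in the bits. -/
def IsAffine {k : ℕ} (φ : (Fin k → Bool) → ℝ) : Prop :=
  ∃ (c : ℝ) (u : Fin k → ℝ), ∀ y, φ y = c + ∑ i, u i * bit (y i)

namespace IsAffine

variable {k : ℕ} {φ ψ : (Fin k → Bool) → ℝ}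

theorem const (c : ℝ) : IsAffine fun _ : Fin k → Bool => c := ⟨c, 0, by simp⟩

theorem bit_apply (i : Fin k) : IsAffine fun y : Fin k → Bool => bit (y i) :=
  ⟨0, fun j => if j = i then 1 else 0, by simp⟩

theorem add (hφ : IsAffine φ) (hψ : IsAffine ψ) : IsAffine fun y => φ y + ψ y := by
  obtain ⟨c, u, h⟩ := hφ
  obtain ⟨d, v, h'⟩ := hψ
  refine ⟨c + d, fun i => u i + v i, fun y => ?_⟩
  simp only [h, h', add_mul, sum_add_distrib]
  ring

theorem const_mul (a : ℝ) (hφ : IsAffine φ) : IsAffine fun y => a * φ y := by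
  obtain ⟨c, u, h⟩ := hφ
  refine ⟨a * c, fun i => a * u i, fun y => ?_⟩
  simp only [h, mul_add, mul_sum, mul_assoc]

theorem sum {β : Type*} (s : Finset β) {Φ : β → (Fin k → Bool) → ℝ}
    (h : ∀ b ∈ s, IsAffine (Φ b)) : IsAffine fun y => ∑ b ∈ s, Φ b y := by
  classical
  induction s using Finset.induction_on with
  | empty => simpa using const 0
  | insert b s hb ih =>
    simp only [sum_insert hb]
    exact (h b (mem_insert_self _ _)).add (ih fun c hc => h c (mem_insert_of_mem hc))

theorem mem_thresholdFunctions (hφ : IsAffine φ) {θ : ℝ} {f : (Fin k → Bool) → Bool}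
    (hf : ∀ y, f y = decide (θ ≤ φ y)) :
    f ∈ thresholdFunctions (fun (y : Fin k → Bool) i => bit (y i)) := by
  obtain ⟨c, u, h⟩ := hφ
  refine Andreev.mem_thresholdFunctions.2 ⟨u, θ - c, fun y => ?_⟩
  rw [hf, h]
  congr 1
  rw [sub_le_iff_le_add']

end IsAffine

section Restrict

variable {k m : ℕ}

theorem isAffine_override (z : Fin k × Fin m → Bool) (J : Fin k → Fin m) (p : Fin k × Fin m) :
    IsAffine fun y => bit (override z J y p) := by
  by_cases h : p.2 = J p.1
  · simpa [override, h] using IsAffine.bit_apply p.1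
  · simpa [override, h] using IsAffine.const (bit (z p))

/-- A function that is constant or depends on a single bit is affine in the bits. -/
theorem isAffine_of_not_survives {D : Finset (Fin k × Fin m)}
    {f : (Fin k × Fin m → Bool) → Bool}
    (hf : ∀ z z', (∀ p ∈ D, z p = z' p) → f z = f z') {z : Fin k × Fin m → Bool}
    {J : Fin k → Fin m} (h : ¬Survives D f z J) :
    IsAffine fun y => bit (f (override z J y)) := by
  by_cases hc : ∀ y y', f (override z J y) = f (override z J y')
  · simpa only [hc _ fun _ => false] using IsAffine.const (bit (f (override z J fun _ => false)))
  · have hlt : ¬1 < (univ.filter fun i => (i, J i) ∈ D).card := by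
      intro h2
      push Not at hc
      exact h ⟨h2, hc⟩
    push Not at hc
    obtain ⟨y₁, y₂, hne⟩ := hc
    obtain ⟨i, hi⟩ : ∃ i, (i, J i) ∈ D := by
      by_contra hno
      push Not at hno
      refine hne (hf _ _ fun p hp => ?_)
      have : p.2 ≠ J p.1 := fun h => hno p.1 (by rw [← h]; exact hp)
      simp [override, this]
    have hdep : ∀ y, f (override z J y) = f (override z J fun _ => y i) := by
      intro y
      refine hf _ _ fun p hp => ?_
      by_cases hpJ : p.2 = J p.1
      · have hpi : p.1 = i := by
          by_contra hpi
          exact hlt (one_lt_card.2 ⟨p.1, by simpa [← hpJ] using hp, i, by simpa using hi, hpi⟩)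
        simp [override, hpJ, hpi]
      · simp [override, hpJ]
    have h1 := (IsAffine.const (k := k) (bit (f (override z J fun _ => false)))).add
      ((IsAffine.bit_apply i).const_mul (bit (f (override z J fun _ => true)) -
        bit (f (override z J fun _ => false))))
    convert h1 using 2 with y
    rw [hdep]
    cases y i <;> simp [bit]

end Restrict

section Gates

variable {α β : Type} [Fintype β] [DecidableEq β]

/-- The threshold of a gate once its inputs from `α` are fixed. -/
noncomputable def residualThreshold (g : LTFGate (α ⊕ β)) (x : α → Bool) : ℝ :=
  g.threshold - ∑ i ∈ g.inputs.toLeft, g.weight (Sum.inl i) * bit (x i)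

/-- The weights of a gate on the inputs from `β`, zero where there is no wire. -/
noncomputable def residualWeight (g : LTFGate (α ⊕ β)) (p : β) : ℝ :=
  if p ∈ g.inputs.toRight then g.weight (Sum.inr p) else 0

theorem gate_eval_sumElim (g : LTFGate (α ⊕ β)) (x : α → Bool) (z : β → Bool) :
    g.eval (Sum.elim x z) =
      decide (residualThreshold g x ≤ ∑ p, residualWeight g p * bit (z p)) := by
  have h : ∑ p, residualWeight g p * bit (z p) =
      ∑ p ∈ g.inputs.toRight, g.weight (Sum.inr p) * bit (z p) := by
    simp only [residualWeight, ite_mul, zero_mul, sum_ite_mem, univ_inter]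
  rw [h, LTFGate.eval, sum_sum_eq_sum_toLeft_add_sum_toRight, residualThreshold]
  congr 1
  rw [sub_le_iff_le_add']
  rfl

end Gates

theorem gate_eval_congr {α : Type} (g : LTFGate α) {z z' : α → Bool}
    (h : ∀ i ∈ g.inputs, z i = z' i) : g.eval z = g.eval z' := by
  unfold LTFGate.eval
  rw [sum_congr rfl fun i hi => by rw [h i hi]]

section Circuit

variable {k : ℕ} (C : LTFLTFCircuit (AndreevVar k))

/-- The function of the block variables computed by a bottom gate when `x` is fixed. -/
noncomputable def gateFun (j : Fin C.numBottom) (x : Fin (2 ^ k) → Bool) (a : Fin k × Fin (2 ^ k / k) → Bool) :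
    Bool :=
  (C.bottom j).eval (Sum.elim x a)

/-- The block variables read by a bottom gate. -/
def gateInputs (j : Fin C.numBottom) : Finset (Fin k × Fin (2 ^ k / k)) :=
  (C.bottom j).inputs.toRight

theorem gateFun_eq (j : Fin C.numBottom) (x : Fin (2 ^ k) → Bool)
    (a : Fin k × Fin (2 ^ k / k) → Bool) :
    gateFun C j x a = decide (residualThreshold (C.bottom j) x ≤
      ∑ p, residualWeight (C.bottom j) p * bit (a p)) :=
  gate_eval_sumElim _ _ _

theorem residualWeight_eq_zero (j : Fin C.numBottom) (p : Fin k × Fin (2 ^ k / k))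
    (hp : p ∉ gateInputs C j) : residualWeight (C.bottom j) p = 0 :=
  if_neg hp

theorem gateFun_congr (j : Fin C.numBottom) (x : Fin (2 ^ k) → Bool)
    (a a' : Fin k × Fin (2 ^ k / k) → Bool) (h : ∀ p ∈ gateInputs C j, a p = a' p) :
    gateFun C j x a = gateFun C j x a' := by
  refine gate_eval_congr _ fun i hi => ?_
  rcases i with i | p
  · rfl
  · exact h p (mem_toRight.2 hi)

/-- The function of the live bits computed by the restricted circuit. -/
noncomputable def restrictedEval (x : Fin (2 ^ k) → Bool) (z : Fin k × Fin (2 ^ k / k) → Bool)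
    (J : Fin k → Fin (2 ^ k / k)) (y : Fin k → Bool) : Bool :=
  C.eval (Sum.elim x (override z J y))

open Classical in
/-- The bottom gates that survive the restriction. -/
noncomputable def survivors (x : Fin (2 ^ k) → Bool) (z : Fin k × Fin (2 ^ k / k) → Bool)
    (J : Fin k → Fin (2 ^ k / k)) : Finset (Fin C.numBottom) :=
  univ.filter fun j => Survives (gateInputs C j) (gateFun C j x) z J

theorem restrictedEval_mem {s : ℕ} (x : Fin (2 ^ k) → Bool)
    (z : Fin k × Fin (2 ^ k / k) → Bool) (J : Fin k → Fin (2 ^ k / k))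
    (hs : (survivors C x z J).card ≤ s) :
    restrictedEval C x z J ∈ depthTwoFunctions k s := by
  classical
  have h1 : IsAffine fun y => ∑ i ∈ C.top.inputs.toLeft,
      C.top.weight (Sum.inl i) * bit ((Sum.elim x (override z J y) : AndreevVar k → Bool) i) := by
    refine IsAffine.sum _ fun i _ => IsAffine.const_mul _ ?_
    rcases i with i | p
    · exact IsAffine.const (bit (x i))
    · exact isAffine_override z J p
  have h2 : IsAffine fun y => ∑ j ∈ univ.filter
        (fun j => ¬Survives (gateInputs C j) (gateFun C j x) z J),
      residualWeight C.top j * bit (gateFun C j x (override z J y)) :=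
    IsAffine.sum _ fun j hj => IsAffine.const_mul _
      (isAffine_of_not_survives (gateFun_congr C j x) (mem_filter.1 hj).2)
  -- The directly read variables and the non-surviving gates together form one affine function: its
  -- linear part becomes weights on the live bits and its constant shifts the threshold.
  obtain ⟨c, u, hcu⟩ := h1.add h2
  refine mem_depthTwoFunctions (survivors C x z J) hs
    (fun j y => gateFun C j x (override z J y)) (fun j _ => ?_) u (residualWeight C.top)
    (C.top.threshold - c) _ fun y => ?_
  · exact IsAffine.mem_thresholdFunctions
      (IsAffine.sum univ fun p _ => (isAffine_override z J p).const_mul _)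
      fun y => gateFun_eq C j x _
  · have h3 := gate_eval_sumElim C.top (Sum.elim x (override z J y))
      fun j => gateFun C j x (override z J y)
    refine h3.trans ?_
    have h4 := hcu y
    have h5 := sum_filter_add_sum_filter_not univ
      (fun j => Survives (gateInputs C j) (gateFun C j x) z J)
      (fun j => residualWeight C.top j * bit (gateFun C j x (override z J y)))
    rw [← h5, residualThreshold]
    congr 1
    refine propext ⟨fun h => ?_, fun h => ?_⟩ <;> unfold survivors at * <;> linarith

/-- The variables `x_p` read by the circuit. -/
def readVars : Finset (Fin (2 ^ k)) :=
  C.top.inputs.toLeft.toLeft ∪ univ.biUnion fun j => (C.bottom j).inputs.toLeft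

theorem card_readVars_le : (readVars C).card ≤ C.wires := by
  rw [LTFLTFCircuit.wires, add_comm]
  refine (card_union_le _ _).trans (add_le_add ?_ ?_)
  · exact card_toLeft_le.trans card_toLeft_le
  · exact card_biUnion_le.trans (sum_le_sum fun j _ => card_toLeft_le)

theorem sum_card_gateInputs_le : ∑ j, (gateInputs C j).card ≤ C.wires :=
  (sum_le_sum fun _ _ => card_toRight_le).trans (Nat.le_add_right _ _)

theorem restrictedEval_congr (z : Fin k × Fin (2 ^ k / k) → Bool) (J : Fin k → Fin (2 ^ k / k))
    (x x' : Fin (2 ^ k) → Bool) (h : ∀ p ∈ readVars C, x p = x' p) :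
    restrictedEval C x z J = restrictedEval C x' z J := by
  funext y
  refine gate_eval_congr _ fun i hi => ?_
  rcases i with (p | q) | j
  · exact h p (mem_union_left _ (mem_toLeft.2 (mem_toLeft.2 hi)))
  · rfl
  · refine gate_eval_congr _ fun i hi => ?_
    rcases i with p | q
    · exact h p (mem_union_right _ (mem_biUnion.2 ⟨j, mem_univ _, mem_toLeft.2 hi⟩))
    · rfl

end Circuit

/-! ### The address after a restriction -/

section Address

variable {k : ℕ}

/-- The address selected by the block parities. -/
def address {m : ℕ} (a : Fin k × Fin m → Bool) : Fin (2 ^ k) :=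
  binIndex fun i => decide ((∑ j, if a (i, j) then (1 : ℕ) else 0) % 2 = 1)

theorem binIndex_injective : Function.Injective (binIndex (k := k)) := by
  intro a b h
  have h1 := finFunctionFinEquiv.injective h
  funext i
  have := congrFun h1 i.rev
  simp only [Fin.rev_rev] at this
  cases ha : a i <;> cases hb : b i <;> simp_all

theorem address_override_injective {m : ℕ} (z : Fin k × Fin m → Bool) (J : Fin k → Fin m) :
    Function.Injective fun y => address (override z J y) := by
  intro y y' h
  have h1 := binIndex_injective h
  funext i
  have h2 := congrFun h1 i
  have h3 : ∀ y : Fin k → Bool, (∑ j, if override z J y (i, j) then (1 : ℕ) else 0) =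
      (if y i then 1 else 0) + ∑ j ∈ univ.erase (J i), if z (i, j) then (1 : ℕ) else 0 := by
    intro y
    rw [← add_sum_erase univ _ (mem_univ (J i))]
    congr 1
    · simp [override]
    · refine sum_congr rfl fun j hj => ?_
      simp [override, (mem_erase.1 hj).1]
  simp only [h3, decide_eq_decide] at h2
  cases hy : y i <;> cases hy' : y' i <;> simp [hy, hy'] at h2 ⊢ <;> omega

/-- The bijection between live bits and addresses. -/
noncomputable def addressEquiv {m : ℕ} (z : Fin k × Fin m → Bool) (J : Fin k → Fin m) :
    (Fin k → Bool) ≃ Fin (2 ^ k) :=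
  Equiv.ofBijective (fun y => address (override z J y))
    ((Fintype.bijective_iff_injective_and_card _).2 ⟨address_override_injective z J, by simp⟩)

end Address

theorem expect_pm_mul_pm {ι : Type} [Fintype ι] [DecidableEq ι] (f g : (ι → Bool) → Bool) :
    𝔼 z, pm (f z) * pm (g z) = 2 * agreement f g - 1 := by
  have h : ∀ z, pm (f z) * pm (g z) = 2 * (if f z = g z then 1 else 0) - 1 := by
    intro z
    cases f z <;> cases g z <;> norm_num [pm]
  simp_rw [h, expect_sub_distrib, ← mul_expect]
  rw [Fintype.expect_eq_sum_div_card, agreement]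
  simp

/-! ### The correlation inequality for circuits -/

section Main

variable {k : ℕ} [NeZero (2 ^ k / k)] (C : LTFLTFCircuit (AndreevVar k))

/-- For each fixed `J`, random fixed bits followed by uniform live bits give a uniform input, so
passing to the restriction loses nothing. -/
theorem expect_correlation_eq :
    2 * agreement C.eval (andreev k) - 1 =
      𝔼 J : Fin k → Fin (2 ^ k / k), 𝔼 z, 𝔼 x : Fin (2 ^ k) → Bool, 𝔼 y,
        pm (restrictedEval C x z J y) * pm (x (addressEquiv z J y)) := by
  rw [← expect_pm_mul_pm]
  have h1 : 𝔼 w : AndreevVar k → Bool, pm (C.eval w) * pm (andreev k w) =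
      𝔼 x : Fin (2 ^ k) → Bool, 𝔼 a : Fin k × Fin (2 ^ k / k) → Bool,
        pm (C.eval (Sum.elim x a)) * pm (x (address a)) := by
    have h := Fintype.expect_equiv (Equiv.sumArrowEquivProdArrow (Fin (2 ^ k))
      (Fin k × Fin (2 ^ k / k)) Bool) (fun w => pm (C.eval w) * pm (andreev k w))
      (fun q => pm (C.eval (Sum.elim q.1 q.2)) * pm (q.1 (address q.2))) fun w => by
        have hw : w = Sum.elim (fun i => w (Sum.inl i)) fun i => w (Sum.inr i) := by
          funext i; cases i <;> rfl
        conv_lhs => rw [hw]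
        rfl
    rw [h, ← univ_product_univ, expect_product]
  have h2 : ∀ J : Fin k → Fin (2 ^ k / k), 𝔼 z, 𝔼 x : Fin (2 ^ k) → Bool, 𝔼 y,
        pm (restrictedEval C x z J y) * pm (x (addressEquiv z J y)) =
      𝔼 w : AndreevVar k → Bool, pm (C.eval w) * pm (andreev k w) := by
    intro J
    rw [expect_comm, h1]
    exact expect_congr rfl fun x _ => expect_override J
      fun a => pm (C.eval (Sum.elim x a)) * pm (x (address a))
  simp_rw [h2]
  exact (Fintype.expect_const _).symm

open Classical in
theorem main_inequality {b : Fin C.numBottom → ℝ}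
    (hb : ∀ j x, survivalProb (gateInputs C j) (gateFun C j x) ≤ b j) (s : ℕ) {l : ℝ}
    (hl : 0 < l) :
    l * 2 ^ k * (2 * agreement C.eval (andreev k) - 1) ≤
      2 * l * 2 ^ k * ((∑ j, b j) / (s + 1)) + Real.log (depthTwoFunctions k s).card +
        l ^ 2 * (readVars C).card / 2 := by
  set A := depthTwoFunctions k s
  set ind : (Fin (2 ^ k) → Bool) → (Fin k × Fin (2 ^ k / k) → Bool) →
    (Fin k → Fin (2 ^ k / k)) → Fin C.numBottom → ℝ := fun x z J j =>
      if Survives (gateInputs C j) (gateFun C j x) z J then 1 else 0 with hind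
  -- Pointwise form of Markov's inequality: leaving the class requires at least `s + 1` survivors.
  have hmarkov : ∀ x z J, (if restrictedEval C x z J ∈ A then (0 : ℝ) else 1) ≤
      (∑ j, ind x z J j) / (s + 1) := by
    intro x z J
    have hsum : ∑ j, ind x z J j = (survivors C x z J).card := by
      simp [hind, survivors]
    rw [hsum]
    split_ifs with h
    · positivity
    · have h1 : ¬(survivors C x z J).card ≤ s := fun hs => h (restrictedEval_mem C x z J hs)
      rw [le_div_iff₀ (by positivity), one_mul]
      exact_mod_cast Nat.lt_of_not_le h1
  have hpt : ∀ J z, l * 2 ^ k * (𝔼 x : Fin (2 ^ k) → Bool, 𝔼 y,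
        pm (restrictedEval C x z J y) * pm (x (addressEquiv z J y))) ≤
      2 * l * 2 ^ k * (𝔼 x, (∑ j, ind x z J j) / (s + 1)) + Real.log A.card +
        l ^ 2 * (readVars C).card / 2 := by
    intro J z
    have h1 := correlation_le (addressEquiv z J) (fun x => restrictedEval C x z J) (readVars C)
      (restrictedEval_congr C z J) A (card_pos.1 (card_depthTwoFunctions_pos k s)) hl
    have h2 : 𝔼 x : Fin (2 ^ k) → Bool, ∑ p,
          pm (restrictedEval C x z J ((addressEquiv z J).symm p)) * pm (x p) =
        2 ^ k * 𝔼 x : Fin (2 ^ k) → Bool, 𝔼 y,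
          pm (restrictedEval C x z J y) * pm (x (addressEquiv z J y)) := by
      rw [mul_expect]
      refine expect_congr rfl fun x _ => ?_
      rw [Fintype.expect_eq_sum_div_card, ← Equiv.sum_comp (addressEquiv z J)]
      simp
      field_simp
    rw [h2, Fintype.card_fin, ← mul_assoc] at h1
    push_cast at h1
    refine h1.trans ?_
    gcongr with x
    refine le_trans (le_of_eq ?_) (hmarkov x z J)
    congr
  have h3 : l * 2 ^ k * (2 * agreement C.eval (andreev k) - 1) ≤
      𝔼 J : Fin k → Fin (2 ^ k / k), 𝔼 z, (2 * l * 2 ^ k * (𝔼 x, (∑ j, ind x z J j) / (s + 1)) +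
        Real.log A.card + l ^ 2 * (readVars C).card / 2) := by
    rw [expect_correlation_eq, mul_expect]
    refine expect_le_expect fun J _ => ?_
    rw [mul_expect]
    exact expect_le_expect fun z _ => hpt J z
  refine h3.trans ?_
  simp_rw [expect_add_distrib, ← mul_expect, Fintype.expect_const]
  have h4 : (𝔼 J : Fin k → Fin (2 ^ k / k), 𝔼 z, 𝔼 x, (∑ j, ind x z J j) / ((s : ℝ) + 1)) ≤
      (∑ j, b j) / (s + 1) := by
    simp_rw [← expect_div]
    gcongr
    simp_rw [expect_sum_comm]
    refine sum_le_sum fun j _ => ?_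
    have h5 : (𝔼 J : Fin k → Fin (2 ^ k / k), 𝔼 z, 𝔼 x, ind x z J j) =
        𝔼 x, survivalProb (gateInputs C j) (gateFun C j x) := by
      rw [expect_congr rfl fun J _ => expect_comm _ _ _, expect_comm]
      rfl
    rw [h5]
    exact expect_le univ_nonempty fun x _ => hb j x
  gcongr

end Main

/-! ### Numerical consequences -/

theorem log_card_depthTwoFunctions_le {k : ℕ} (hk : 1 ≤ k) (s : ℕ) :
    Real.log (depthTwoFunctions k s).card ≤ 3 * (k : ℝ) ^ 2 * (2 * s + 1) := by
  have hpos : (0 : ℝ) < (depthTwoFunctions k s).card := by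
    exact_mod_cast card_depthTwoFunctions_pos k s
  have h1 : ((depthTwoFunctions k s).card : ℝ) ≤
      2 ^ ((k + 1) * ((k + 1) * s + (k + s + 1))) := by
    exact_mod_cast card_depthTwoFunctions_le k s
  have h2 := Real.log_le_log hpos h1
  rw [Real.log_pow] at h2
  have h3 : (k + 1) * ((k + 1) * s + (k + s + 1)) ≤ 4 * k ^ 2 * (2 * s + 1) := by
    have : (k + 1) * s + (k + s + 1) ≤ (k + 1) * (2 * s + 1) := by nlinarith [Nat.zero_le (k * s)]
    calc _ ≤ (k + 1) * ((k + 1) * (2 * s + 1)) := by gcongr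
      _ = (k + 1) ^ 2 * (2 * s + 1) := by ring
      _ ≤ (2 * k) ^ 2 * (2 * s + 1) := by gcongr; omega
      _ = _ := by ring
  have h4 : (((k + 1) * ((k + 1) * s + (k + s + 1)) : ℕ) : ℝ) ≤ 4 * (k : ℝ) ^ 2 * (2 * s + 1) := by
    exact_mod_cast h3
  -- The constant `3` absorbs `4 * log 2`.
  have h5 := Real.log_two_lt_d9
  have h6 : 0 < Real.log 2 := Real.log_pos (by norm_num)
  have h7 : (0 : ℝ) ≤ (k : ℝ) ^ 2 * (2 * s + 1) := by positivity
  nlinarith [mul_le_mul_of_nonneg_right h4 h6.le]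

theorem survivors_or_reads {k : ℕ} [NeZero (2 ^ k / k)] (hk : 1 ≤ k)
    (C : LTFLTFCircuit (AndreevVar k)) {ε : ℝ} (hε : 0 < ε)
    (hC : 1 / 2 + ε ≤ agreement C.eval (andreev k)) {b : Fin C.numBottom → ℝ}
    (hb : ∀ j x, survivalProb (gateInputs C j) (gateFun C j x) ≤ b j) :
    ε ^ 3 * 2 ^ k / (48 * (k : ℝ) ^ 2) ≤ ∑ j, b j ∨
      (ε ^ 2 * 2 ^ k ≤ 24 * (k : ℝ) ^ 2 ∧
        ε ^ 2 * (2 ^ k) ^ 2 ≤ 6 * (k : ℝ) ^ 2 * (readVars C).card) := by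
  have hk0 : (0 : ℝ) < k := by exact_mod_cast hk
  set N : ℝ := 2 ^ k with hN
  have hN0 : 0 < N := by positivity
  set B := ∑ j, b j with hB
  set X : ℝ := ε ^ 2 * N / (24 * (k : ℝ) ^ 2) with hX
  have hX0 : 0 ≤ X := by positivity
  have hXe : X * (24 * (k : ℝ) ^ 2) = ε ^ 2 * N := by rw [hX]; field_simp
  -- This budget keeps the entropy term a constant fraction of `ε ^ 2 * N` when `s ≥ 1`; the case `s
  -- = 0` is treated with another `l`.
  set s := ⌊X⌋₊ with hs
  have hs1 : X < s + 1 := Nat.lt_floor_add_one X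
  have hs0 : (s : ℝ) ≤ X := Nat.floor_le hX0
  have htarget : ε / 2 * X = ε ^ 3 * N / (48 * (k : ℝ) ^ 2) := by rw [hX]; field_simp; ring
  have hBs : ε / 2 * (s + 1) ≤ B → ε ^ 3 * N / (48 * (k : ℝ) ^ 2) ≤ B := by
    intro h
    rw [← htarget]
    refine le_trans ?_ h
    gcongr
  have hL := log_card_depthTwoFunctions_le hk s
  have hmain : ∀ l : ℝ, 0 < l → l * N * (2 * ε) ≤ 2 * l * N * (B / (s + 1)) +
      3 * (k : ℝ) ^ 2 * (2 * s + 1) + l ^ 2 * (readVars C).card / 2 := by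
    intro l hl
    have h1 := main_inequality C hb s hl
    have h2 : l * N * (2 * ε) ≤ l * N * (2 * agreement C.eval (andreev k) - 1) := by
      gcongr
      linarith
    linarith
  rcases Nat.eq_zero_or_pos s with h0 | hpos
  · rw [h0] at hmain hs1 hBs
    simp only [Nat.cast_zero, mul_zero, zero_add, mul_one, div_one] at hmain hs1 hBs
    by_cases hcase : ε / 2 ≤ B
    · exact Or.inl (hBs hcase)
    · right
      push Not at hcase
      -- This makes the gain `l * N * ε` twice the entropy term `3 * k ^ 2`, so the variance term
      -- must cover the rest, which forces many reads of `x`.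
      set l : ℝ := 6 * (k : ℝ) ^ 2 / (ε * N) with hl
      have hl0 : 0 < l := by positivity
      have hle : l * N * ε = 6 * (k : ℝ) ^ 2 := by rw [hl]; field_simp
      have h1 := hmain l hl0
      have h2 : l * N * B ≤ l * N * (ε / 2) := by gcongr
      have h3 : 6 * (k : ℝ) ^ 2 ≤ l ^ 2 * (readVars C).card := by nlinarith
      refine ⟨by nlinarith, ?_⟩
      have h4 : l ^ 2 * (ε ^ 2 * N ^ 2) = 36 * (k : ℝ) ^ 2 * (k : ℝ) ^ 2 := by
        calc _ = (l * N * ε) ^ 2 := by ring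
          _ = _ := by rw [hle]; ring
      have h5 : l ^ 2 * (ε ^ 2 * N ^ 2) ≤ l ^ 2 * (6 * (k : ℝ) ^ 2 * (readVars C).card) := by
        rw [h4]
        have := mul_le_mul_of_nonneg_left h3 (show 0 ≤ 6 * (k : ℝ) ^ 2 by positivity)
        linarith
      exact le_of_mul_le_mul_left h5 (by positivity)
  · left
    apply hBs
    have hs' : (1 : ℝ) ≤ s := by exact_mod_cast hpos
    -- With `l = ε`, the entropy and variance terms are at most `3/8` and `1/2` of `ε ^ 2 * N`,
    -- against `2 * ε ^ 2 * N` on the left.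
    have h1 := hmain ε hε
    have hR : ((readVars C).card : ℝ) ≤ N := by
      have : (readVars C).card ≤ 2 ^ k := by simpa using card_le_univ (readVars C)
      rw [hN]
      exact_mod_cast this
    have h2 : ε ^ 2 * (readVars C).card ≤ ε ^ 2 * N := by gcongr
    have h3 : 3 * (k : ℝ) ^ 2 * (2 * s + 1) ≤ 9 * (k : ℝ) ^ 2 * X := by
      have : (k : ℝ) ^ 2 * (2 * s + 1) ≤ (k : ℝ) ^ 2 * (3 * X) := by gcongr; linarith
      linarith
    have h4 : ε * N * ε ≤ ε * N * (2 * (B / (s + 1))) := by nlinarith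
    have h5 := le_of_mul_le_mul_left h4 (by positivity)
    have h6 : ε / 2 ≤ B / (s + 1) := by linarith
    rwa [le_div_iff₀ (by positivity)] at h6

theorem sq_le_two_mul_two_pow (k : ℕ) : k ^ 2 ≤ 2 * 2 ^ k := by
  induction k with
  | zero => simp
  | succ k ih =>
    rcases Nat.lt_or_ge k 3 with h | h
    · interval_cases k <;> norm_num
    · calc (k + 1) ^ 2 = k * k + 2 * k + 1 := by ring
        _ ≤ 2 * k ^ 2 := by nlinarith
        _ ≤ 2 * (2 * 2 ^ k) := by gcongr
        _ = _ := by ring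

theorem two_pow_le_mul_div {k : ℕ} (hk : 1 ≤ k) : (2 : ℝ) ^ k ≤ 2 * k * (2 ^ k / k : ℕ) := by
  have h1 : 1 ≤ 2 ^ k / k := (Nat.one_le_div_iff (by omega)).2 Nat.lt_two_pow_self.le
  have h2 : 2 ^ k < k * (2 ^ k / k + 1) := Nat.lt_mul_div_succ _ (by omega)
  have h3 : 2 ^ k ≤ 2 * k * (2 ^ k / k) := by nlinarith
  exact_mod_cast h3

/-! ### Survival bounds in terms of `k` -/

section Bounds

variable {k : ℕ} (C : LTFLTFCircuit (AndreevVar k))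

/-- A gate reads at most `k * m` block variables, and rounding `2 ^ k / k` down loses at most a
factor `2`. -/
theorem card_gateInputs_div_le (hk : 1 ≤ k) (j : Fin C.numBottom) :
    ((gateInputs C j).card : ℝ) / (2 ^ k / k : ℕ) ^ 2 ≤ 2 * (k : ℝ) ^ 2 / 2 ^ k := by
  have hN := two_pow_le_mul_div hk
  have hk0 : (0 : ℝ) < k := by exact_mod_cast hk
  have hN0 : (0 : ℝ) < 2 ^ k := by positivity
  set m := 2 ^ k / k with hm
  have hm0 : (0 : ℝ) < m := by
    by_contra h
    have : 2 * (k : ℝ) * m ≤ 0 := mul_nonpos_of_nonneg_of_nonpos (by positivity) (not_lt.1 h)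
    linarith
  have hd : ((gateInputs C j).card : ℝ) ≤ k * m := by
    have : (gateInputs C j).card ≤ k * m := by simpa [hm] using card_le_univ (gateInputs C j)
    exact_mod_cast this
  rw [div_le_div_iff₀ (by positivity) hN0]
  calc _ ≤ (k * m : ℝ) * (2 * k * m) := by gcongr
    _ = _ := by ring

theorem card_gateInputs_div_le_four (hk : 1 ≤ k) (j : Fin C.numBottom) :
    ((gateInputs C j).card : ℝ) / (2 ^ k / k : ℕ) ^ 2 ≤ 4 := by
  refine (card_gateInputs_div_le C hk j).trans ?_
  rw [div_le_iff₀ (by positivity)]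
  have : ((k ^ 2 : ℕ) : ℝ) ≤ (2 * 2 ^ k : ℕ) := by exact_mod_cast sq_le_two_mul_two_pow k
  push_cast at this
  linarith

variable [NeZero (2 ^ k / k)]

theorem survivalProb_gate_le (hk : 1 ≤ k) (j : Fin C.numBottom) (x : Fin (2 ^ k) → Bool) :
    survivalProb (gateInputs C j) (gateFun C j x) ≤ 24 * k / √(2 ^ k) := by
  refine (survivalProb_le_sqrt (gateFun_eq C j x) (residualWeight_eq_zero C j)
    (card_gateInputs_div_le_four C hk j)).trans ?_
  have hr : √(2 ^ k : ℝ) ^ 2 = 2 ^ k := Real.sq_sqrt (by positivity)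
  have h1 : √(((gateInputs C j).card : ℝ) / (2 ^ k / k : ℕ) ^ 2) ≤ 3 / 2 * (k / √(2 ^ k)) := by
    rw [Real.sqrt_le_left (by positivity)]
    refine (card_gateInputs_div_le C hk j).trans ?_
    rw [mul_pow, div_pow (k : ℝ), hr, mul_div_assoc]
    gcongr
    norm_num
  calc _ ≤ 16 * (3 / 2 * (k / √(2 ^ k))) := by gcongr
    _ = _ := by ring

theorem survivalProb_gate_le_card (hk : 1 ≤ k) (j : Fin C.numBottom) (x : Fin (2 ^ k) → Bool) :
    survivalProb (gateInputs C j) (gateFun C j x) ≤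
      (gateInputs C j).card * (54 * (k * √k) / (2 ^ k * √(2 ^ k))) := by
  refine (survivalProb_le_card (gateFun_eq C j x) (residualWeight_eq_zero C j)
    (card_gateInputs_div_le_four C hk j)).trans ?_
  have hk0 : (0 : ℝ) < k := by exact_mod_cast hk
  have hN := two_pow_le_mul_div hk
  set m := 2 ^ k / k with hm
  have hm0 : (0 : ℝ) < m := by
    exact_mod_cast Nat.pos_of_ne_zero (NeZero.ne (2 ^ k / k))
  have h1 : √(2 ^ k : ℝ) ≤ 3 / 2 * (√k * √m) := by
    rw [Real.sqrt_le_left (by positivity), mul_pow, mul_pow, Real.sq_sqrt hk0.le,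
      Real.sq_sqrt hm0.le]
    nlinarith [mul_pos hk0 hm0]
  have h2 : (2 : ℝ) ^ k * √(2 ^ k) ≤ (2 * k * m) * (3 / 2 * (√k * √m)) := by gcongr
  have hsm : 0 < √(m : ℝ) := Real.sqrt_pos.2 hm0
  have hsk : 0 < √(k : ℝ) := Real.sqrt_pos.2 hk0
  rw [← mul_div_assoc, ← mul_div_assoc, div_le_div_iff₀ (by positivity) (by positivity)]
  calc _ ≤ 18 * ((gateInputs C j).card : ℝ) * ((2 * k * m) * (3 / 2 * (√k * √m))) := by gcongr
    _ = _ := by ring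

end Bounds

theorem gates_lower_bound {k : ℕ} (hk : 1 ≤ k) (C : LTFLTFCircuit (AndreevVar k)) {ε : ℝ}
    (hε : 0 < ε) (hC : 1 / 2 + ε ≤ agreement C.eval (andreev k)) :
    ε ^ 3 * (2 ^ k * √(2 ^ k)) / (k : ℝ) ^ 3 ≤ 1152 * C.gates := by
  have : NeZero (2 ^ k / k) :=
    ⟨(Nat.div_pos Nat.lt_two_pow_self.le hk).ne'⟩
  have hk0 : (0 : ℝ) < k := by exact_mod_cast hk
  have hr0 : 0 < √(2 ^ k : ℝ) := by positivity
  have hr : √(2 ^ k : ℝ) * √(2 ^ k : ℝ) = 2 ^ k := Real.mul_self_sqrt (by positivity)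
  have hg : (C.gates : ℝ) = C.numBottom + 1 := by simp [LTFLTFCircuit.gates]
  rw [div_le_iff₀ (by positivity), hg]
  set r := √(2 ^ k : ℝ) with hrdef
  rcases survivors_or_reads hk C hε hC (survivalProb_gate_le C hk) with h | ⟨h, -⟩
  · rw [sum_const, card_univ, Fintype.card_fin, nsmul_eq_mul, ← mul_div_assoc,
      div_le_div_iff₀ (by positivity) hr0] at h
    have h2 : (0 : ℝ) ≤ 1152 * (k : ℝ) ^ 3 := by positivity
    nlinarith
  -- Here `ε ^ 3 * 2 ^ (3k/2)` is at most `125 * k ^ 3`, so the output gate alone suffices. The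
  -- constant `1152 = 48 * 24` comes from the other case.
  · rw [← hr] at h ⊢
    have h1 : ε * r ≤ 5 * k := by
      refine (le_abs_self _).trans (abs_le_of_sq_le_sq ?_ (by positivity))
      nlinarith [sq_nonneg (k : ℝ)]
    have h2 : (ε * r) ^ 3 ≤ (5 * k) ^ 3 := by gcongr
    have h3 : (0 : ℝ) ≤ C.numBottom * (k : ℝ) ^ 3 := by positivity
    nlinarith [pow_pos hk0 3]

theorem wires_lower_bound {k : ℕ} (hk : 1 ≤ k) (C : LTFLTFCircuit (AndreevVar k)) {ε : ℝ}
    (hε : 0 < ε) (hC : 1 / 2 + ε ≤ agreement C.eval (andreev k)) :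
    ε ^ 3 * ((2 ^ k) ^ 2 * √(2 ^ k)) / ((k : ℝ) ^ 3 * √k) ≤ 2592 * C.wires := by
  have : NeZero (2 ^ k / k) :=
    ⟨(Nat.div_pos Nat.lt_two_pow_self.le hk).ne'⟩
  have hk1 : (1 : ℝ) ≤ k := by exact_mod_cast hk
  have hk0 : (0 : ℝ) < k := by linarith
  have hr0 : 0 < √(2 ^ k : ℝ) := by positivity
  have hr : √(2 ^ k : ℝ) * √(2 ^ k : ℝ) = 2 ^ k := Real.mul_self_sqrt (by positivity)
  have hκ : 1 ≤ √(k : ℝ) := Real.one_le_sqrt.2 hk1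
  have hκ0 : 0 < √(k : ℝ) := by linarith
  rw [div_le_iff₀ (by positivity)]
  rcases survivors_or_reads hk C hε hC (survivalProb_gate_le_card C hk) with h | ⟨h, h'⟩
  · have hW : (∑ j, ((gateInputs C j).card : ℝ)) ≤ C.wires := by
      exact_mod_cast sum_card_gateInputs_le C
    rw [← sum_mul] at h
    have h1 := h.trans (mul_le_mul_of_nonneg_right hW (by positivity))
    rw [← mul_div_assoc, div_le_div_iff₀ (by positivity) (by positivity)] at h1
    nlinarith
  -- Each `x_p` that is read uses a wire, which gives the constant `30`. The constant `2592 = 48 *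
  -- 54` comes from the other case.
  · have hW : ((readVars C).card : ℝ) ≤ C.wires := by exact_mod_cast card_readVars_le C
    have h1 : ε * √(2 ^ k : ℝ) ≤ 5 * k := by
      refine (le_abs_self _).trans (abs_le_of_sq_le_sq ?_ (by positivity))
      nlinarith [sq_nonneg (k : ℝ)]
    calc ε ^ 3 * ((2 ^ k) ^ 2 * √(2 ^ k : ℝ)) = ε ^ 2 * (2 ^ k) ^ 2 * (ε * √(2 ^ k : ℝ)) := by ring
      _ ≤ 6 * (k : ℝ) ^ 2 * (readVars C).card * (5 * k) := by gcongr
      _ ≤ 6 * (k : ℝ) ^ 2 * C.wires * (5 * k) := by gcongr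
      _ = 30 * C.wires * ((k : ℝ) ^ 3 * 1) := by ring
      _ ≤ 2592 * C.wires * ((k : ℝ) ^ 3 * √k) := by gcongr; norm_num

theorem rpow_three_halves {a : ℝ} (ha : 0 < a) : a ^ (3 / 2 : ℝ) = a * √a := by
  rw [show (3 / 2 : ℝ) = 1 + 1 / 2 by norm_num, Real.rpow_add ha, Real.rpow_one, Real.sqrt_eq_rpow]

theorem rpow_five_halves {a : ℝ} (ha : 0 < a) : a ^ (5 / 2 : ℝ) = a ^ 2 * √a := by
  rw [show (5 / 2 : ℝ) = (2 : ℕ) + 1 / 2 by norm_num, Real.rpow_add ha, Real.rpow_natCast,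
    Real.sqrt_eq_rpow]

theorem rpow_seven_halves {a : ℝ} (ha : 0 < a) : a ^ (7 / 2 : ℝ) = a ^ 3 * √a := by
  rw [show (7 / 2 : ℝ) = (3 : ℕ) + 1 / 2 by norm_num, Real.rpow_add ha, Real.rpow_natCast,
    Real.sqrt_eq_rpow]

theorem half_le_log_two_mul_two_pow (k : ℕ) : (k : ℝ) / 2 ≤ Real.log (2 * 2 ^ k) := by
  rw [← pow_succ', Real.log_pow]
  have h := Real.log_two_gt_d9
  push_cast
  have : (0 : ℝ) ≤ k := Nat.cast_nonneg k
  nlinarith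

theorem sqrt_two_mul_le (a : ℝ) : √(2 * a) ≤ 3 / 2 * √a := by
  rw [Real.sqrt_mul zero_le_two]
  gcongr
  rw [Real.sqrt_le_left (by norm_num)]
  norm_num

end Andreev

theorem theorem1 :
    ∃ K : ℝ, 0 < K ∧ ∃ c : ℝ, 0 < c ∧
      ∀ k : ℕ, 1 ≤ k → ∀ n : ℕ, n = 2 * 2 ^ k →
        ∀ ε : ℝ, K * Real.sqrt (Real.log n / n) ≤ ε →
          ∀ f : (AndreevVar k → Bool) → Bool, 1 / 2 + ε ≤ agreement f (andreev k) →
            ∀ C : LTFLTFCircuit (AndreevVar k), (∀ z, C.eval z = f z) →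
              c * (ε ^ 3 * (n : ℝ) ^ (3 / 2 : ℝ) / Real.log n ^ 3) ≤ (C.gates : ℝ) ∧
              c * (ε ^ 3 * (n : ℝ) ^ (5 / 2 : ℝ) / Real.log n ^ (7 / 2 : ℝ)) ≤ (C.wires : ℝ) := by
  -- Passing from `k` and `2 ^ k` to `log n` and `n` costs factors `24` and `72`; both `24 * 1152`
  -- and `72 * 2592` are below `200000`.
  refine ⟨1, one_pos, 1 / 200000, by norm_num, ?_⟩
  intro k hk n hn ε hε f hf C hCf
  obtain rfl : C.eval = f := funext hCf
  have hncast : (n : ℝ) = 2 * 2 ^ k := by rw [hn]; push_cast; rfl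
  have hk0 : (0 : ℝ) < k := by exact_mod_cast hk
  have hlog := Andreev.half_le_log_two_mul_two_pow k
  have hε0 : 0 < ε := by
    refine lt_of_lt_of_le ?_ hε
    rw [one_mul, hncast]
    have : 0 < Real.log (2 * 2 ^ k) := by linarith
    positivity
  rw [hncast]
  have hL0 : 0 < Real.log (2 * 2 ^ k) := by linarith
  set L := Real.log (2 * 2 ^ k) with hL
  have hr := Andreev.sqrt_two_mul_le (2 ^ k)
  have hG := Andreev.gates_lower_bound hk C hε0 hf
  have hW := Andreev.wires_lower_bound hk C hε0 hf
  have hL3 : (k : ℝ) ^ 3 / 8 ≤ L ^ 3 := by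
    calc (k : ℝ) ^ 3 / 8 = (k / 2) ^ 3 := by ring
      _ ≤ L ^ 3 := by gcongr
  have hκ : 0 < √(k : ℝ) := Real.sqrt_pos.2 hk0
  have hsL : √(k : ℝ) * (2 / 3) ≤ √L := by
    have h1 := Andreev.sqrt_two_mul_le ((k : ℝ) / 2)
    rw [mul_div_cancel₀ _ (two_ne_zero)] at h1
    have h2 := Real.sqrt_le_sqrt hlog
    linarith
  constructor
  · rw [Andreev.rpow_three_halves (by positivity)]
    have h1 : ε ^ 3 * (2 * 2 ^ k * √(2 * 2 ^ k)) / L ^ 3 ≤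
        ε ^ 3 * (2 * 2 ^ k * (3 / 2 * √(2 ^ k))) / ((k : ℝ) ^ 3 / 8) := by gcongr
    have h2 : ε ^ 3 * (2 * 2 ^ k * (3 / 2 * √(2 ^ k))) / ((k : ℝ) ^ 3 / 8) =
        24 * (ε ^ 3 * (2 ^ k * √(2 ^ k)) / (k : ℝ) ^ 3) := by field_simp; ring
    have h3 : (0 : ℝ) ≤ C.gates := Nat.cast_nonneg _
    linarith
  · rw [Andreev.rpow_five_halves (by positivity), Andreev.rpow_seven_halves hL0]
    have h1 : ε ^ 3 * ((2 * 2 ^ k) ^ 2 * √(2 * 2 ^ k)) / (L ^ 3 * √L) ≤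
        ε ^ 3 * ((2 * 2 ^ k) ^ 2 * (3 / 2 * √(2 ^ k))) /
          ((k : ℝ) ^ 3 / 8 * (√(k : ℝ) * (2 / 3))) := by gcongr
    have h2 : ε ^ 3 * ((2 * 2 ^ k) ^ 2 * (3 / 2 * √(2 ^ k))) /
          ((k : ℝ) ^ 3 / 8 * (√(k : ℝ) * (2 / 3))) =
        72 * (ε ^ 3 * ((2 ^ k) ^ 2 * √(2 ^ k)) / ((k : ℝ) ^ 3 * √k)) := by field_simp; ring
    have h3 : (0 : ℝ) ≤ C.wires := Nat.cast_nonneg _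
    linarith
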